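/- **Conventions.** Write $dA = d^2z/\pi$, $\partial=\tfrac12(\partial_x-i\partial_y)$ and $\Delta=\partial\bar\partial$. A compact set $K\subset\mathbb C$ is a *local droplet* of a potential $Q$ if there is an open neighbourhood $U$ of $K$ such that $K$ is the droplet of the localised potential $Q_{\overline U}$ ($=Q$ on $\overline U$, $=+\infty$ off $\overline U$); that is, $\Delta Q\,\mathbf 1_K\,dA$ is a probability measure with support $K$, and it minimises $$I_{Q}[\mu]=\iint\log\frac1{|z-w|}\,d\mu(z)\,d\mu(w)+\int Q\,d\mu$$ among all probability measures $\mu$ of finite energy carried by $\overline U$. A compact set in the plane is called *simply connected* if it is connected and has no holes, i.e. its complement is connected. **Lemma 5.1.** Let $t_0>0$, let $r_\infty$ be a rational function, and let $H^0$ be a (single-valued) real harmonic function off the poles of $r_\infty$ with $\partial H^0=r_\infty$. Put $$Q^0(z)=\frac1{t_0}\bigl(|z|^2-H^0(z)\bigr),\qquad Q(z)=Q^0(z)-2\sum_{j=1}^m c_j\log|z-a_j|,$$ with $a_1,\dots,a_m\in\mathbb C$ and $c_1,\dots,c_m\in\mathbb R$. Let $K$ be a connected local droplet of $Q$, and let $\Omega_\infty$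 be the unbounded component of $K^c$. Assume that every finite pole of $r_\infty$ lies in $\Omega_\infty$ and that every $a_j$ lies in a bounded component of $K^c$. Let $K^0=\mathbb C\setminus\Omega_\infty$ and $c=c_1+\dots+c_m$. Then $K^0$ is simply connected, and $K^0$ is a local droplet of the potential $Q^0/(1+c)$. -/

import Mathlib

open MeasureTheory Set

noncomputable section

namespace HeleShaw

/-- The Wirtinger derivative `∂f = (∂ₓ f - i ∂_y f) / 2` of a real-valued function on the plane. -/
def wirtinger (f : ℂ → ℝ) (z : ℂ) : ℂ :=
  (((fderiv ℝ f z 1 : ℝ) : ℂ) - Complex.I * ((fderiv ℝ f z Complex.I : ℝ) : ℂ)) / 2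

/-- `H` is a (single-valued) real harmonic function off the finite set of poles of the rational
function `r`, and `∂H = r` there.  The values of `H` at the poles of `r` are irrelevant. -/
structure IsHarmonicWith (H : ℂ → ℝ) (r : RatFunc ℂ) : Prop where
  harmonic : ∀ z : ℂ, ¬ r.denom.IsRoot z → InnerProductSpace.HarmonicAt H z
  deriv : ∀ z : ℂ, ¬ r.denom.IsRoot z → wirtinger H z = r.eval (RingHom.id ℂ) z

/-- The Hele-Shaw potential `(|z|² - H(z)) / t`. It is an algebraic Hele-Shaw potential when
`0 < t` and `IsHarmonicWith H r` for some rational function `r`. -/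
def potential (t : ℝ) (H : ℂ → ℝ) (z : ℂ) : ℝ := (‖z‖ ^ 2 - H z) / t

/-- The measure `ΔQ · 1_K dA`, where `Δ = ∂∂̄` is a quarter of the usual Laplacian and
`dA = d²z / π`. -/
def dropletMeasure (Q : ℂ → ℝ) (K : Set ℂ) : Measure ℂ :=
  (volume.restrict K).withDensity
    (fun z => ENNReal.ofReal (Real.pi⁻¹ * (4⁻¹ * Laplacian.laplacian Q z)))

/-- `ν` has finite logarithmic energy and finite potential energy. A measure with an atom has
infinite logarithmic energy; this is required separately because the real-valued logarithm
takes the value `0` at `0`. -/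
structure FiniteEnergy (Q : ℂ → ℝ) (ν : Measure ℂ) : Prop where
  no_atoms : ∀ z : ℂ, ν {z} = 0
  log_integrable : Integrable (fun p : ℂ × ℂ => Real.log (1 / ‖p.1 - p.2‖)) (ν.prod ν)
  pot_integrable : Integrable Q ν

/-- The weighted logarithmic energy `I_Q[ν] = ∬ log (1 / |z - w|) dν(z) dν(w) + ∫ Q dν`
(meaningful for measures of finite energy). -/
def energy (Q : ℂ → ℝ) (ν : Measure ℂ) : ℝ :=
  (∫ p : ℂ × ℂ, Real.log (1 / ‖p.1 - p.2‖) ∂(ν.prod ν)) + ∫ z, Q z ∂ν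

/-- `K` is the droplet of the localisation of `Q` to `S`, the potential which equals `Q` on `S`
and `+∞` off `S`: the measure `ΔQ · 1_K dA` is a probability measure with support `K`, and it
minimises the weighted logarithmic energy among all probability measures. For the localised
potential, only measures of finite energy that are carried by `S` compete. -/
structure IsDropletOn (Q : ℂ → ℝ) (S K : Set ℂ) : Prop where
  compact : IsCompact K
  subset : K ⊆ S
  prob : IsProbabilityMeasure (dropletMeasure Q K)
  support_eq : (dropletMeasure Q K).support = K
  finite_energy : FiniteEnergy Q (dropletMeasure Q K)
  minimal : ∀ ν : Measure ℂ, IsProbabilityMeasure ν → ν Sᶜ = 0 → FiniteEnergy Q ν →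
    energy Q (dropletMeasure Q K) ≤ energy Q ν

/-- `K` is a local droplet of `Q`: it is the droplet of the localisation of `Q` to the closure of
some open neighbourhood of `K`. -/
def IsLocalDroplet (Q : ℂ → ℝ) (K : Set ℂ) : Prop :=
  ∃ U : Set ℂ, IsOpen U ∧ K ⊆ U ∧ IsDropletOn Q (closure U) K

/-- The unbounded component of the complement of a compact set `K`. -/
def outerComponent (K : Set ℂ) : Set ℂ :=
  {z | z ∈ Kᶜ ∧ ¬ Bornology.IsBounded (connectedComponentIn Kᶜ z)}

/-- The set `K` with its holes filled: the complement of the unbounded component of `Kᶜ`. -/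
def filled (K : Set ℂ) : Set ℂ := (outerComponent K)ᶜ

/-- A compact set in the plane is simply connected if it is connected and has no holes, that is,
its complement is connected. -/
structure IsSimplyConnectedCompact (K : Set ℂ) : Prop where
  compact : IsCompact K
  connected : IsConnected K
  compl_connected : IsConnected Kᶜ

end HeleShaw

end

/-! ### Integrals over discs of harmonic functions, the squared norm and the logarithm -/

noncomputable section

namespace HeleShaw

open Metric Filter Topology

/-! Let `W = filled K \ K` be the union of the holes and `b j = t₀ * c j`. Minimality of the area
measure on `K` gives the Euler-Lagrange conditions: with a suitable constant `γ` and `u = H₀ + t₀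
γ`, the function `Φ(z) = |z|² - (2/π) ∫_K log|z-w| - u(z) - 2 ∑ b j log|z - a j|` vanishes on `K`
and is nonnegative near `K`. Inside the holes its ordinary Laplacian is `4 - 4π ∑ b j δ_{a j}`.

The crux is that `h = 1_W Φ` has exactly this Laplacian on the whole plane, with no contribution
from the boundary of the holes, although nothing is known about the regularity of that boundary.
Since `Φ ≥ 0` near `K` and `Φ = 0` on `K`, comparing disc means about nearby points gives `Φ =
O(dist(·, K)²)` in the holes (`SolvesObstacle.le_sq_infDist`). Hence the mean-value difference
quotients of `h`, with the point masses removed, stay bounded, and they tend to `0` at every point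
outside `W` where `W` has density zero, that is, almost everywhere outside `W`
(`norm_meanLaplacian_le`, `tendsto_meanLaplacian`).

Since `h` is supported in a bounded set, testing against `1` gives `area W = π ∑ b j`
(`volume_holes`), and testing against `log|· - z₀|` gives `h = (2/π) ∫_W log|·-w| - 2 ∑ b j log|· -
a j|` (`holeObstacle_eq`). Thus sweeping the charges out over the holes leaves the potential
unchanged outside them. The filled set has area `π t₀ (1 + c)`, and its obstacle function for the
new potential is a positive multiple of `Φ - h`: it is zero on the filled set and equals a multiple
of `Φ ≥ 0` outside it, near `K`.

These inequalities imply minimality, because the logarithmic energy of a difference of two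
probability measures is nonnegative (`log_energy_nonneg`): Frullani's formula writes the logarithmic
kernel, up to a constant, as a superposition of positive definite Gaussians. Simple connectedness is
plane topology: the closure of every hole meets `K`, and the exterior of a large disc is connected.
-/

theorem integrableOn_polarCoord_symm {f : ℂ → ℝ} (hf : Integrable f) :
    IntegrableOn (fun p : ℝ × ℝ => p.1 * f (Complex.polarCoord.symm p)) polarCoord.target := by
  have h1 : Integrable (f ∘ Complex.measurableEquivRealProd.symm) :=
    (Complex.volume_preserving_equiv_real_prod.symm.integrable_comp_emb
      Complex.measurableEquivRealProd.symm.measurableEmbedding).2 hf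
  have h2 : IntegrableOn (f ∘ Complex.measurableEquivRealProd.symm)
      (polarCoord.symm '' polarCoord.target) := h1.integrableOn
  rw [integrableOn_image_iff_integrableOn_abs_det_fderiv_smul volume
    polarCoord.open_target.measurableSet
    (fun p _ => (hasFDerivAt_polarCoord_symm p).hasFDerivWithinAt) polarCoord.symm.injOn] at h2
  refine h2.congr_fun (fun p hp => ?_) polarCoord.open_target.measurableSet
  have : |p.1| = p.1 := abs_of_pos hp.1
  simp only [det_fderivPolarCoordSymm, this, smul_eq_mul, Function.comp_apply,
    Complex.measurableEquivRealProd_symm_polarCoord_symm_apply]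

theorem polarCoord_symm_eq_circleMap (r θ : ℝ) :
    Complex.polarCoord.symm (r, θ) = circleMap 0 r θ := by
  simp only [Complex.polarCoord_symm_apply, circleMap_zero, Complex.exp_mul_I, Complex.ofReal_cos,
    Complex.ofReal_sin]

theorem integral_Ioo_neg_pi_pi_eq_circleAverage (f : ℂ → ℝ) (z : ℂ) (r : ℝ) :
    ∫ θ in Ioo (-Real.pi) Real.pi, f (circleMap z r θ) =
      2 * Real.pi * Real.circleAverage f z r := by
  have hp : Function.Periodic (fun θ => f (circleMap z r θ)) (2 * Real.pi) := fun θ => by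
    simp only [periodic_circleMap z r θ]
  have h := hp.intervalIntegral_add_eq (-Real.pi) 0
  rw [show -Real.pi + 2 * Real.pi = Real.pi by ring, zero_add] at h
  rw [← integral_Ioc_eq_integral_Ioo, ← intervalIntegral.integral_of_le (by linarith [Real.pi_pos]),
    h, Real.circleAverage_def, smul_eq_mul]
  field_simp [Real.pi_ne_zero]

/-- The integral over a disc is the integral of circle averages. -/
theorem integral_closedBall_eq_circleAverage {u : ℂ → ℝ} {z : ℂ} {R : ℝ} (hR : 0 ≤ R)
    (hu : IntegrableOn u (closedBall z R)) :
    ∫ x in closedBall z R, u x = ∫ r in (0 : ℝ)..R, 2 * Real.pi * r * Real.circleAverage u z r := by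
  set f : ℂ → ℝ := fun x => (closedBall z R).indicator u (z + x) with hfdef
  have hf : Integrable f :=
    ((integrable_indicator_iff measurableSet_closedBall).2 hu).comp_add_left z
  have hint := integrableOn_polarCoord_symm hf
  have h1 : ∫ x in closedBall z R, u x = ∫ x, f x := by
    rw [← integral_indicator measurableSet_closedBall]
    exact (integral_add_left_eq_self _ z).symm
  rw [h1, ← Complex.integral_comp_polarCoord_symm f, polarCoord_target]
  rw [polarCoord_target] at hint
  simp only [smul_eq_mul]
  rw [Measure.volume_eq_prod, setIntegral_prod _ hint, intervalIntegral.integral_of_le hR,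
    ← integral_indicator measurableSet_Ioi, ← integral_indicator measurableSet_Ioc]
  congr 1
  ext r
  by_cases hr : 0 < r
  · rw [indicator_of_mem (show r ∈ Ioi (0 : ℝ) from hr), integral_const_mul]
    by_cases hrR : r ≤ R
    · rw [indicator_of_mem (show r ∈ Ioc 0 R from ⟨hr, hrR⟩), mul_comm (2 * Real.pi) r, mul_assoc,
        ← integral_Ioo_neg_pi_pi_eq_circleAverage]
      congr 2
      ext θ
      rw [hfdef]
      simp only [polarCoord_symm_eq_circleMap]
      have : z + circleMap 0 r θ = circleMap z r θ := by simp [circleMap]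
      rw [this, indicator_of_mem]
      rw [mem_closedBall, dist_eq_norm, circleMap_sub_center, norm_circleMap_zero, abs_of_pos hr]
      exact hrR
    · rw [indicator_of_notMem (fun h => hrR h.2)]
      have : ∀ θ : ℝ, f (Complex.polarCoord.symm (r, θ)) = 0 := by
        intro θ
        rw [hfdef]
        simp only [polarCoord_symm_eq_circleMap]
        rw [indicator_of_notMem]
        rw [mem_closedBall, dist_eq_norm, add_sub_cancel_left, norm_circleMap_zero, abs_of_pos hr]
        exact hrR
      simp only [this, integral_zero, mul_zero]
  · rw [indicator_of_notMem (show r ∉ Ioi (0 : ℝ) from hr), indicator_of_notMem (fun h => hr h.1)]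

theorem integral_closedBall_harmonic {u : ℂ → ℝ} {z : ℂ} {R : ℝ} (hR : 0 ≤ R)
    (hu : InnerProductSpace.HarmonicOnNhd u (closedBall z R)) :
    ∫ x in closedBall z R, u x = Real.pi * R ^ 2 * u z := by
  rw [integral_closedBall_eq_circleAverage hR
    (hu.continuousOn.integrableOn_compact (isCompact_closedBall z R))]
  have : ∫ r in (0 : ℝ)..R, 2 * Real.pi * r * Real.circleAverage u z r =
      ∫ r in (0 : ℝ)..R, (2 * Real.pi * u z) * r := by
    refine intervalIntegral.integral_congr fun r hr => ?_
    rw [uIcc_of_le hR] at hr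
    have : Real.circleAverage u z r = u z := by
      refine InnerProductSpace.HarmonicOnNhd.circleAverage_eq (hu.mono ?_)
      rw [abs_of_nonneg hr.1]
      exact closedBall_subset_closedBall hr.2
    simp only [this]
    ring
  rw [this, intervalIntegral.integral_const_mul, integral_id]
  ring

theorem circleAverage_norm_sq (z : ℂ) (r : ℝ) :
    Real.circleAverage (fun x => ‖x‖ ^ 2) z r = ‖z‖ ^ 2 + r ^ 2 := by
  have h : ∀ θ : ℝ, ‖circleMap z r θ‖ ^ 2 =
      (‖z‖ ^ 2 + r ^ 2) + (2 * r * z.re) * Real.cos θ + (2 * r * z.im) * Real.sin θ := by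
    intro θ
    have hc : circleMap z r θ = ⟨z.re + r * Real.cos θ, z.im + r * Real.sin θ⟩ := by
      apply Complex.ext <;> simp [circleMap]
    rw [hc, ← Complex.normSq_eq_norm_sq, ← Complex.normSq_eq_norm_sq, Complex.normSq_apply,
      Complex.normSq_apply]
    linear_combination r ^ 2 * Real.sin_sq_add_cos_sq θ
  rw [Real.circleAverage_def]
  simp only [h]
  rw [intervalIntegral.integral_add (Continuous.intervalIntegrable (by fun_prop) _ _)
    (Continuous.intervalIntegrable (by fun_prop) _ _),
    intervalIntegral.integral_add (Continuous.intervalIntegrable (by fun_prop) _ _)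
    (Continuous.intervalIntegrable (by fun_prop) _ _),
    intervalIntegral.integral_const_mul, intervalIntegral.integral_const_mul, integral_cos,
    integral_sin]
  simp
  field_simp

theorem integral_closedBall_norm_sq (z : ℂ) {R : ℝ} (hR : 0 ≤ R) :
    ∫ x in closedBall z R, ‖x‖ ^ 2 = Real.pi * R ^ 2 * (‖z‖ ^ 2 + R ^ 2 / 2) := by
  have hc : Continuous fun x : ℂ => ‖x‖ ^ 2 := by fun_prop
  rw [integral_closedBall_eq_circleAverage hR
    (hc.continuousOn.integrableOn_compact (isCompact_closedBall z R))]
  simp only [circleAverage_norm_sq]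
  have : ∀ r : ℝ, 2 * Real.pi * r * (‖z‖ ^ 2 + r ^ 2) =
      (2 * Real.pi * ‖z‖ ^ 2) * r + (2 * Real.pi) * r ^ 3 := fun r => by ring
  simp only [this]
  rw [intervalIntegral.integral_add (Continuous.intervalIntegrable (by fun_prop) _ _)
    (Continuous.intervalIntegrable (by fun_prop) _ _),
    intervalIntegral.integral_const_mul, intervalIntegral.integral_const_mul, integral_id,
    integral_pow]
  norm_num
  ring

theorem integrableOn_closedBall_log_norm (R : ℝ) :
    IntegrableOn (fun x : ℂ => Real.log ‖x‖) (closedBall 0 R) := by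
  refine IntegrableOn.mono_set ?_ (closedBall_subset_ball (lt_add_one R))
  refine (integrableOn_fun_norm_addHaar (volume : Measure ℂ) (f := Real.log)).2 ?_
  simp only [Complex.finrank_real_complex, Nat.add_one_sub_one, pow_one, smul_eq_mul]
  exact (Real.continuous_mul_log.continuousOn.integrableOn_compact
    (isCompact_Icc (a := (0 : ℝ)) (b := R + 1))).mono_set Ioo_subset_Icc_self

theorem integrableOn_log_norm_sub (w : ℂ) {S : Set ℂ} (hS : Bornology.IsBounded S) :
    IntegrableOn (fun x : ℂ => Real.log ‖x - w‖) S := by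
  obtain ⟨R, hR⟩ := hS.subset_closedBall w
  refine IntegrableOn.mono_set ?_ hR
  rw [← integrable_indicator_iff measurableSet_closedBall]
  have h := ((integrable_indicator_iff measurableSet_closedBall).2
    (integrableOn_closedBall_log_norm R)).comp_sub_right w
  refine h.congr (Eventually.of_forall fun x => ?_)
  by_cases hx : x ∈ closedBall w R
  · rw [indicator_of_mem hx]
    exact indicator_of_mem (by simpa [dist_eq_norm] using hx) _
  · rw [indicator_of_notMem hx]
    exact indicator_of_notMem (by simpa [dist_eq_norm] using hx) _

theorem integral_mul_log_eq {a b : ℝ} (ha : 0 ≤ a) (hab : a ≤ b) :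
    ∫ r in a..b, r * Real.log r =
      (b ^ 2 / 2 * Real.log b - b ^ 2 / 4) - (a ^ 2 / 2 * Real.log a - a ^ 2 / 4) := by
  have hcm := Real.continuous_mul_log
  refine intervalIntegral.integral_eq_sub_of_hasDerivAt_of_le
    (f := fun r => r ^ 2 / 2 * Real.log r - r ^ 2 / 4) hab ?_ ?_ ?_
  · have : (fun r : ℝ => r ^ 2 / 2 * Real.log r - r ^ 2 / 4) =
        fun r => r / 2 * (r * Real.log r) - r ^ 2 / 4 := by ext r; ring
    rw [this]
    fun_prop
  · intro x hx
    have hx0 : x ≠ 0 := (ha.trans_lt hx.1).ne'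
    have h := (((hasDerivAt_pow 2 x).div_const 2).mul (Real.hasDerivAt_log hx0)).sub
      ((hasDerivAt_pow 2 x).div_const 4)
    refine h.congr_deriv ?_
    field_simp
    simp
    ring
  · exact hcm.intervalIntegrable _ _

/-- The excess of the integral of `log ‖·‖` over the disc of radius `R` about `w` over
`π R² log ‖w‖`. -/
def logExcess (R : ℝ) (w : ℂ) : ℝ :=
  if ‖w‖ < R then
    Real.pi * R ^ 2 * (Real.log R - Real.log ‖w‖ - 1 / 2 + ‖w‖ ^ 2 / (2 * R ^ 2)) else 0

theorem logExcess_eq_zero {R : ℝ} {w : ℂ} (h : R ≤ ‖w‖) : logExcess R w = 0 :=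
  if_neg h.not_gt

/-- With `s = (‖w‖ / R)²` the bracket is `(s - 1 - log s) / 2`. The point `w = 0` is excluded
because the convention `log 0 = 0` can make the value there negative. -/
theorem logExcess_nonneg {R : ℝ} {w : ℂ} (hw : w ≠ 0) : 0 ≤ logExcess R w := by
  unfold logExcess
  split_ifs with h
  · have hw0 : 0 < ‖w‖ := norm_pos_iff.2 hw
    have hR : 0 < R := hw0.trans h
    have h1 := Real.add_one_le_exp (2 * (Real.log ‖w‖ - Real.log R))
    have h2 : Real.exp (2 * (Real.log ‖w‖ - Real.log R)) = ‖w‖ ^ 2 / R ^ 2 := by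
      rw [mul_comm, Real.exp_mul, Real.exp_sub, Real.exp_log hw0, Real.exp_log hR]
      rw [Real.rpow_ofNat, div_pow]
    rw [h2] at h1
    have h3 : ‖w‖ ^ 2 / (2 * R ^ 2) = (‖w‖ ^ 2 / R ^ 2) / 2 := by field_simp
    rw [h3]
    exact mul_nonneg (by positivity) (by linarith)
  · exact le_rfl

/-- The mean of `log ‖· - w‖` over the circle of radius `r` about `z` is `log (max r ‖z - w‖)`, so
the radial integral splits at `r = ‖z - w‖`. The formula survives at `z = w`: the first term is then
`0` by convention and `logExcess R 0` is the full integral. -/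
theorem integral_closedBall_log (z w : ℂ) {R : ℝ} (hR : 0 < R) :
    ∫ x in closedBall z R, Real.log ‖x - w‖ =
      Real.pi * R ^ 2 * Real.log ‖z - w‖ + logExcess R (z - w) := by
  rw [integral_closedBall_eq_circleAverage hR.le (integrableOn_log_norm_sub w isBounded_closedBall)]
  set s := ‖z - w‖ with hs
  have hs0 : 0 ≤ s := norm_nonneg _
  have hlow : ∀ r, 0 ≤ r → r ≤ s → 2 * Real.pi * r *
      Real.circleAverage (fun x => Real.log ‖x - w‖) z r = 2 * Real.pi * Real.log s * r := by
    intro r hr hrs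
    rcases hr.eq_or_lt with rfl | hr0
    · simp
    rw [circleAverage_log_norm_sub_const_eq_log_radius_add_posLog hr0.ne', ← hs]
    have : 1 ≤ |r⁻¹ * s| := by
      rw [abs_of_nonneg (by positivity)]
      field_simp
      exact hrs
    rw [Real.posLog_eq_log this, Real.log_mul (by positivity) (by linarith), Real.log_inv]
    ring
  have hhigh : ∀ r, 0 ≤ r → s ≤ r → 2 * Real.pi * r *
      Real.circleAverage (fun x => Real.log ‖x - w‖) z r = 2 * Real.pi * (r * Real.log r) := by
    intro r hr hrs
    rcases hr.eq_or_lt with rfl | hr0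
    · simp
    rw [circleAverage_log_norm_sub_const_eq_log_radius_add_posLog hr0.ne', ← hs]
    have : |r⁻¹ * s| ≤ 1 := by
      rw [abs_of_nonneg (by positivity)]
      field_simp
      exact hrs
    rw [(Real.posLog_eq_zero_iff _).2 this]
    ring
  have hI1 : ∀ b, 0 ≤ b → b ≤ s → ∫ r in (0 : ℝ)..b, 2 * Real.pi * r *
      Real.circleAverage (fun x => Real.log ‖x - w‖) z r = Real.pi * b ^ 2 * Real.log s := by
    intro b hb hbs
    rw [intervalIntegral.integral_congr (g := fun r => 2 * Real.pi * Real.log s * r)]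
    · rw [intervalIntegral.integral_const_mul, integral_id]
      ring
    · intro r hr
      rw [uIcc_of_le hb] at hr
      exact hlow r hr.1 (hr.2.trans hbs)
  rcases le_or_gt R s with hRs | hsR
  · rw [logExcess_eq_zero hRs, hI1 R hR.le hRs, add_zero]
  · have hint1 : IntervalIntegrable (fun r => 2 * Real.pi * r *
        Real.circleAverage (fun x => Real.log ‖x - w‖) z r) volume 0 s := by
      refine IntervalIntegrable.congr (f := fun r => 2 * Real.pi * Real.log s * r) ?_
        (Continuous.intervalIntegrable (by fun_prop) _ _)
      intro r hr
      rw [uIoc_of_le hs0] at hr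
      exact (hlow r hr.1.le hr.2).symm
    have hint2 : IntervalIntegrable (fun r => 2 * Real.pi * r *
        Real.circleAverage (fun x => Real.log ‖x - w‖) z r) volume s R := by
      refine IntervalIntegrable.congr (f := fun r => 2 * Real.pi * (r * Real.log r)) ?_
        (Continuous.intervalIntegrable (Real.continuous_mul_log.const_mul _) _ _)
      intro r hr
      rw [uIoc_of_le hsR.le] at hr
      exact (hhigh r (hs0.trans hr.1.le) hr.1.le).symm
    have hI2 : ∫ r in s..R, 2 * Real.pi * r *
        Real.circleAverage (fun x => Real.log ‖x - w‖) z r =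
        2 * Real.pi * ((R ^ 2 / 2 * Real.log R - R ^ 2 / 4) - (s ^ 2 / 2 * Real.log s - s ^ 2 / 4)) := by
      rw [intervalIntegral.integral_congr (g := fun r => 2 * Real.pi * (r * Real.log r)),
        intervalIntegral.integral_const_mul, integral_mul_log_eq hs0 hsR.le]
      intro r hr
      rw [uIcc_of_le hsR.le] at hr
      exact hhigh r (hs0.trans hr.1) hr.1
    rw [← intervalIntegral.integral_add_adjacent_intervals hint1 hint2, hI1 s hs0 le_rfl, hI2,
      logExcess, if_pos hsR, ← hs]
    field_simp
    ring

theorem integrable_logExcess (R : ℝ) : Integrable (logExcess R) := by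
  have h : logExcess R = (ball (0 : ℂ) R).indicator (fun w => Real.pi * R ^ 2 *
      (Real.log R - Real.log ‖w‖ - 1 / 2 + ‖w‖ ^ 2 / (2 * R ^ 2))) := by
    ext w
    simp only [logExcess, indicator, mem_ball_zero_iff]
  rw [h, integrable_indicator_iff measurableSet_ball]
  have hl : IntegrableOn (fun x : ℂ => Real.log ‖x‖) (ball 0 R) :=
    (integrableOn_closedBall_log_norm R).mono_set ball_subset_closedBall
  have hc : ∀ f : ℂ → ℝ, Continuous f → IntegrableOn f (ball 0 R) := fun f hf =>
    (hf.continuousOn.integrableOn_compact (isCompact_closedBall (0 : ℂ) R)).mono_set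
      ball_subset_closedBall
  have h1 := ((((hc (fun _ => Real.log R) continuous_const).sub hl).sub
    (hc (fun _ => 1 / 2) continuous_const)).add
    (hc (fun w => ‖w‖ ^ 2 / (2 * R ^ 2)) (by fun_prop))).const_mul (Real.pi * R ^ 2)
  exact h1

/-- This fixes the normalisation: multiplied by `8 / (π R⁴)`, the total mass is `2π`, the mass of
the Laplacian of `log ‖·‖`. -/
theorem integral_logExcess {R : ℝ} (hR : 0 < R) :
    ∫ w, logExcess R w = Real.pi ^ 2 * R ^ 4 / 4 := by
  let g : ℝ → ℝ := fun s => if s < R then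
    Real.pi * R ^ 2 * (Real.log R - Real.log s - 1 / 2 + s ^ 2 / (2 * R ^ 2)) else 0
  have h := integral_fun_norm_addHaar (volume : Measure ℂ) g
  have hball : (volume : Measure ℂ).real (ball 0 1) = Real.pi := by
    rw [Measure.real, Complex.volume_ball]
    simp
  simp only [Complex.finrank_real_complex, hball, smul_eq_mul, nsmul_eq_mul, Nat.add_one_sub_one,
    pow_one] at h
  have h0 : ∫ w, logExcess R w = ∫ w : ℂ, g ‖w‖ := rfl
  have h1 : ∫ y in Ioi (0 : ℝ), y * g y = ∫ y in (0 : ℝ)..R, Real.pi * R ^ 2 *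
      ((Real.log R - 1 / 2) * y - y * Real.log y + 1 / (2 * R ^ 2) * y ^ 3) := by
    rw [intervalIntegral.integral_of_le hR.le, integral_Ioc_eq_integral_Ioo,
      ← integral_indicator measurableSet_Ioi, ← integral_indicator measurableSet_Ioo]
    congr 1
    ext y
    by_cases hy : y ∈ Ioo 0 R
    · rw [indicator_of_mem (show y ∈ Ioi (0 : ℝ) from hy.1), indicator_of_mem hy]
      simp only [g, if_pos hy.2]
      ring
    · rw [indicator_of_notMem hy]
      by_cases hy0 : 0 < y
      · rw [indicator_of_mem (show y ∈ Ioi (0 : ℝ) from hy0)]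
        simp only [g]
        rw [if_neg fun h => hy ⟨hy0, h⟩, mul_zero]
      · exact indicator_of_notMem hy0 _
  rw [h0, h, h1, intervalIntegral.integral_const_mul, intervalIntegral.integral_add,
    intervalIntegral.integral_sub, intervalIntegral.integral_const_mul, integral_id,
    integral_mul_log_eq le_rfl hR.le, intervalIntegral.integral_const_mul, integral_pow]
  · norm_num
    field_simp
    ring
  · exact Continuous.intervalIntegrable (by fun_prop) _ _
  · exact Real.continuous_mul_log.intervalIntegrable _ _
  · exact Continuous.intervalIntegrable (by have := Real.continuous_mul_log; fun_prop) _ _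
  · exact Continuous.intervalIntegrable (by fun_prop) _ _

end HeleShaw

end

/-! ### Logarithmic potentials of area measures and disc averaging -/

noncomputable section

namespace HeleShaw

open Metric Filter Topology

/-- The (negative of the) logarithmic potential of Lebesgue measure on `K`. -/
def logPotential (K : Set ℂ) (z : ℂ) : ℝ := ∫ w in K, Real.log ‖z - w‖

theorem integrableOn_log_norm_sub' (z : ℂ) {S : Set ℂ} (hS : Bornology.IsBounded S) :
    IntegrableOn (fun w : ℂ => Real.log ‖z - w‖) S := by
  simpa only [norm_sub_rev] using integrableOn_log_norm_sub z hS

theorem ae_ne (z : ℂ) : ∀ᵐ w : ℂ, w ≠ z := by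
  simp [ae_iff]

/-- The differences `z - w` stay in a fixed disc, so the kernel agrees on `S ×ˢ K` with the
integrand of the convolution of the indicator of `K` with the logarithm cut off to that disc. -/
theorem integrable_log_norm_prod {S K : Set ℂ} (hS : Bornology.IsBounded S)
    (hK : Bornology.IsBounded K) (hSm : MeasurableSet S) (hKm : MeasurableSet K) :
    Integrable (fun p : ℂ × ℂ => Real.log ‖p.1 - p.2‖)
      ((volume.restrict S).prod (volume.restrict K)) := by
  obtain ⟨D, hD⟩ := (hS.sub hK).subset_closedBall 0
  have hF : Integrable ((closedBall (0 : ℂ) D).indicator fun x => Real.log ‖x‖) :=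
    (integrable_indicator_iff measurableSet_closedBall).2 (integrableOn_closedBall_log_norm D)
  have h1 : Integrable (K.indicator fun _ => (1 : ℝ)) :=
    (integrable_indicator_iff hKm).2 (integrableOn_const hK.measure_lt_top.ne)
  have h := h1.convolution_integrand (ContinuousLinearMap.mul ℝ ℝ) hF
  rw [Measure.prod_restrict]
  refine (h.integrableOn (s := S ×ˢ K)).congr_fun ?_ (hSm.prod hKm)
  rintro ⟨x, w⟩ ⟨hx, hw⟩
  have : x - w ∈ closedBall (0 : ℂ) D := hD (sub_mem_sub hx hw)
  simp only [ContinuousLinearMap.mul_apply', indicator_of_mem hw, one_mul, indicator_of_mem this]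

/-- Truncation changes the integrand only on the disc of radius `ε` about `z`, where the full
integral of `log (ε / ‖w - z‖)` is `π ε² / 2`. The bound does not depend on `z`, so the potential is
a uniform limit of continuous functions. -/
theorem abs_logPotential_sub_le {K : Set ℂ} (hK : IsCompact K) {ε : ℝ} (hε : 0 < ε) (z : ℂ) :
    |logPotential K z - ∫ w in K, Real.log (max ε ‖z - w‖)| ≤ Real.pi * ε ^ 2 / 2 := by
  have hc : Continuous fun w : ℂ => Real.log (max ε ‖z - w‖) :=
    Continuous.log (by fun_prop) fun w => (lt_of_lt_of_le hε (le_max_left _ _)).ne'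
  have hi2 : IntegrableOn (fun w : ℂ => Real.log (max ε ‖z - w‖)) K :=
    hc.continuousOn.integrableOn_compact hK
  have hi1 := integrableOn_log_norm_sub' z hK.isBounded
  have hconst : IntegrableOn (fun _ : ℂ => Real.log ε) (closedBall z ε) :=
    integrableOn_const isBounded_closedBall.measure_lt_top.ne
  have hball : IntegrableOn (fun w : ℂ => Real.log ε - Real.log ‖w - z‖) (closedBall z ε) :=
    hconst.sub
      (integrableOn_log_norm_sub z isBounded_closedBall)
  have hval : ∫ w in closedBall z ε, (Real.log ε - Real.log ‖w - z‖) = Real.pi * ε ^ 2 / 2 := by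
    rw [integral_sub hconst
      (integrableOn_log_norm_sub z isBounded_closedBall), integral_closedBall_log z z hε]
    simp [logExcess, hε, Measure.real, Complex.volume_closedBall, hε.le]
    ring
  have hind : Integrable ((closedBall z ε).indicator fun w => Real.log ε - Real.log ‖w - z‖) :=
    (integrable_indicator_iff measurableSet_closedBall).2 hball
  have hpt : ∀ w, w ≠ z → ‖Real.log ‖z - w‖ - Real.log (max ε ‖z - w‖)‖ ≤
      (closedBall z ε).indicator (fun w => Real.log ε - Real.log ‖w - z‖) w := by
    intro w hw
    have hpos : 0 < ‖w - z‖ := norm_pos_iff.2 (sub_ne_zero.2 hw)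
    rw [norm_sub_rev z w]
    by_cases h : ‖w - z‖ ≤ ε
    · rw [indicator_of_mem (by simpa [dist_eq_norm] using h), max_eq_left h, Real.norm_eq_abs,
        abs_sub_comm, abs_of_nonneg (sub_nonneg.2 (Real.log_le_log hpos h))]
    · rw [indicator_of_notMem (by simpa [dist_eq_norm] using h), max_eq_right (not_le.1 h).le]
      simp
  have hnn : ∀ w, w ≠ z →
      0 ≤ (closedBall z ε).indicator (fun w => Real.log ε - Real.log ‖w - z‖) w := fun w hw =>
    (norm_nonneg _).trans (hpt w hw)
  rw [logPotential, ← integral_sub hi1 hi2, ← Real.norm_eq_abs]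
  calc ‖∫ w in K, (Real.log ‖z - w‖ - Real.log (max ε ‖z - w‖))‖
      ≤ ∫ w in K, (closedBall z ε).indicator (fun w => Real.log ε - Real.log ‖w - z‖) w := by
        refine norm_integral_le_of_norm_le hind.integrableOn ?_
        filter_upwards [ae_restrict_of_ae (ae_ne z)] with w hw using hpt w hw
    _ ≤ ∫ w, (closedBall z ε).indicator (fun w => Real.log ε - Real.log ‖w - z‖) w := by
        refine setIntegral_le_integral hind ?_
        filter_upwards [ae_ne z] with w hw using hnn w hw
    _ = Real.pi * ε ^ 2 / 2 := by
        rw [integral_indicator measurableSet_closedBall, hval]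

theorem continuous_logPotential {K : Set ℂ} (hK : IsCompact K) : Continuous (logPotential K) := by
  have hunif : TendstoUniformly (fun (ε : ℝ) z => ∫ w in K, Real.log (max ε ‖z - w‖))
      (logPotential K) (𝓝[>] 0) := by
    rw [Metric.tendstoUniformly_iff]
    intro η hη
    have h1 : Tendsto (fun ε : ℝ => Real.pi * ε ^ 2 / 2) (𝓝[>] 0) (𝓝 0) := by
      have : Continuous fun ε : ℝ => Real.pi * ε ^ 2 / 2 := by fun_prop
      simpa using (this.tendsto 0).mono_left nhdsWithin_le_nhds
    filter_upwards [h1.eventually (gt_mem_nhds hη), self_mem_nhdsWithin] with ε h hε z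
    rw [Real.dist_eq]
    exact (abs_logPotential_sub_le hK hε z).trans_lt h
  refine hunif.continuous (Eventually.frequently ?_)
  filter_upwards [self_mem_nhdsWithin] with ε hε
  have : Continuous (Function.uncurry fun z w : ℂ => Real.log (max ε ‖z - w‖)) :=
    Continuous.log (by fun_prop) fun w => (lt_of_lt_of_le (mem_Ioi.1 hε) (le_max_left _ _)).ne'
  exact continuous_parametric_integral_of_continuous this hK

/-- Fubini for the logarithmic kernel. -/
theorem setIntegral_logPotential_comm {S K : Set ℂ} (hS : IsCompact S) (hK : IsCompact K) :
    ∫ z in S, logPotential K z = ∫ z in K, logPotential S z := by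
  unfold logPotential
  rw [integral_integral_swap (integrable_log_norm_prod hS.isBounded hK.isBounded hS.measurableSet
    hK.measurableSet)]
  simp only [norm_sub_rev]

theorem integrable_logExcess_sub (R : ℝ) (z : ℂ) : Integrable fun w => logExcess R (z - w) :=
  (integrable_logExcess R).comp_sub_left z

theorem integral_closedBall_logPotential {K : Set ℂ} (hK : IsCompact K) (z : ℂ) {R : ℝ}
    (hR : 0 < R) :
    ∫ x in closedBall z R, logPotential K x =
      Real.pi * R ^ 2 * logPotential K z + ∫ w in K, logExcess R (z - w) := by
  rw [setIntegral_logPotential_comm (isCompact_closedBall z R) hK]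
  have : ∀ w : ℂ, logPotential (closedBall z R) w =
      Real.pi * R ^ 2 * Real.log ‖z - w‖ + logExcess R (z - w) := fun w => by
    rw [← integral_closedBall_log z w hR, logPotential]
    simp only [norm_sub_rev]
  simp only [this]
  rw [integral_add ((integrableOn_log_norm_sub' z hK.isBounded).const_mul _)
    (integrable_logExcess_sub R z).integrableOn, integral_const_mul]
  rfl

theorem setIntegral_logExcess_nonneg (K : Set ℂ) (z : ℂ) (R : ℝ) :
    0 ≤ ∫ w in K, logExcess R (z - w) := by
  refine integral_nonneg_of_ae ?_
  filter_upwards [ae_restrict_of_ae (ae_ne z)] with w hw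
  exact logExcess_nonneg (sub_ne_zero.2 hw.symm)

theorem setIntegral_logExcess_eq_zero {K : Set ℂ} {z : ℂ} {R : ℝ}
    (h : ∀ w ∈ K, R ≤ ‖z - w‖) : ∫ w in K, logExcess R (z - w) = 0 :=
  setIntegral_eq_zero_of_forall_eq_zero fun w hw => logExcess_eq_zero (h w hw)

/-- The kernels `8 / (π R⁴) * logExcess R` form an approximate identity of total mass `2π`. -/
theorem tendsto_integral_logExcess_mul {v : ℂ → ℝ} {z : ℂ} (hv : ContinuousAt v z)
    (hm : AEStronglyMeasurable v) :
    Tendsto (fun R : ℝ => 8 / (Real.pi * R ^ 4) * ∫ w, logExcess R (w - z) * v w) (𝓝[>] 0)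
      (𝓝 (2 * Real.pi * v z)) := by
  rw [Metric.tendsto_nhds]
  intro η hη
  -- The kernels have mass `2π`, so oscillation `η / (4π)` contributes at most `η / 2`.
  obtain ⟨δ, hδ, hδv⟩ := Metric.continuousAt_iff.1 hv (η / (4 * Real.pi))
    (div_pos hη (by positivity))
  filter_upwards [Ioo_mem_nhdsGT hδ] with R hR
  have hR0 : 0 < R := hR.1
  have hz : ∀ w, w ≠ z → 0 ≤ logExcess R (w - z) := fun w hw => logExcess_nonneg (sub_ne_zero.2 hw)
  have hi : Integrable fun w => logExcess R (w - z) := (integrable_logExcess R).comp_sub_right z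
  have htot : ∫ w, logExcess R (w - z) = Real.pi ^ 2 * R ^ 4 / 4 := by
    rw [integral_sub_right_eq_self (logExcess R) z, integral_logExcess hR0]
  have hclose : ∀ w, w ≠ z → ‖logExcess R (w - z) * (v w - v z)‖ ≤
      logExcess R (w - z) * (η / (4 * Real.pi)) := by
    intro w hw
    rw [norm_mul, Real.norm_of_nonneg (hz w hw)]
    by_cases h : R ≤ ‖w - z‖
    · simp [logExcess_eq_zero h]
    · refine mul_le_mul_of_nonneg_left ?_ (hz w hw)
      have : dist w z < δ := by rw [dist_eq_norm]; linarith [hR.2]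
      exact (hδv this).le
  have hd : Integrable fun w => logExcess R (w - z) * (v w - v z) := by
    refine (hi.mul_const (η / (4 * Real.pi))).mono' ?_ ?_
    · exact hi.aestronglyMeasurable.mul (hm.sub aestronglyMeasurable_const)
    · filter_upwards [ae_ne z] with w hw using hclose w hw
  have hsplit : ∫ w, logExcess R (w - z) * v w =
      (∫ w, logExcess R (w - z) * (v w - v z)) + Real.pi ^ 2 * R ^ 4 / 4 * v z := by
    rw [← htot, ← integral_mul_const, ← integral_add hd (hi.mul_const _)]
    congr 1
    ext w
    ring
  have hbound : |∫ w, logExcess R (w - z) * (v w - v z)| ≤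
      Real.pi ^ 2 * R ^ 4 / 4 * (η / (4 * Real.pi)) := by
    rw [← htot, ← integral_mul_const, ← Real.norm_eq_abs]
    refine norm_integral_le_of_norm_le (hi.mul_const _) ?_
    filter_upwards [ae_ne z] with w hw using hclose w hw
  rw [Real.dist_eq, hsplit]
  have e : 8 / (Real.pi * R ^ 4) * ((∫ w, logExcess R (w - z) * (v w - v z)) +
      Real.pi ^ 2 * R ^ 4 / 4 * v z) - 2 * Real.pi * v z =
      8 / (Real.pi * R ^ 4) * ∫ w, logExcess R (w - z) * (v w - v z) := by
    field_simp
    ring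
  rw [e, abs_mul, abs_of_pos (by positivity)]
  calc _ ≤ 8 / (Real.pi * R ^ 4) * (Real.pi ^ 2 * R ^ 4 / 4 * (η / (4 * Real.pi))) := by gcongr
    _ = η / 2 := by field_simp; ring
    _ < η := by linarith

/-- Averaging over discs is a symmetric operator. -/
theorem integral_closedBall_mul_comm {u ψ : ℂ → ℝ} (hu : Integrable u) (hψ : Integrable ψ) (R : ℝ) :
    ∫ z, (∫ x in closedBall z R, u x) * ψ z = ∫ x, u x * ∫ z in closedBall x R, ψ z := by
  have hset : MeasurableSet {p : ℂ × ℂ | dist p.1 p.2 ≤ R} :=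
    measurableSet_le (by fun_prop) measurable_const
  have hint : Integrable ({p : ℂ × ℂ | dist p.1 p.2 ≤ R}.indicator fun p => ψ p.1 * u p.2)
      (volume.prod volume) := (hψ.mul_prod hu).indicator hset
  have h := integral_integral_swap (f := fun z x =>
    ({p : ℂ × ℂ | dist p.1 p.2 ≤ R}.indicator fun p => ψ p.1 * u p.2) (z, x)) hint
  have e1 : ∀ z, ∫ x, ({p : ℂ × ℂ | dist p.1 p.2 ≤ R}.indicator fun p => ψ p.1 * u p.2) (z, x) =
      (∫ x in closedBall z R, u x) * ψ z := by
    intro z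
    rw [mul_comm, ← integral_const_mul, ← integral_indicator measurableSet_closedBall]
    congr 1
    ext x
    simp only [indicator, mem_ofPred_eq, mem_closedBall, dist_comm]
  have e2 : ∀ x, ∫ z, ({p : ℂ × ℂ | dist p.1 p.2 ≤ R}.indicator fun p => ψ p.1 * u p.2) (z, x) =
      u x * ∫ z in closedBall x R, ψ z := by
    intro x
    rw [← integral_const_mul, ← integral_indicator measurableSet_closedBall]
    congr 1
    ext z
    simp only [indicator, mem_ofPred_eq, mem_closedBall, mul_comm]
  simp only [e1, e2] at h
  exact h

end HeleShaw

end

/-! ### Plane topology: the unbounded component and the filled set -/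

noncomputable section

namespace HeleShaw

open Metric Filter Topology

/-- The exterior of the disc is the image of a half-plane under the exponential. -/
theorem isConnected_compl_closedBall {R : ℝ} (hR : 0 < R) :
    IsConnected (closedBall (0 : ℂ) R)ᶜ := by
  have h : (closedBall (0 : ℂ) R)ᶜ = Complex.exp '' {z | Real.log R < z.re} := by
    ext w
    simp only [mem_compl_iff, mem_closedBall, dist_zero_right, not_le, mem_image, mem_ofPred_eq]
    constructor
    · intro hw
      have hw0 : w ≠ 0 := norm_pos_iff.1 (hR.trans hw)
      exact ⟨Complex.log w, by rw [Complex.log_re]; exact Real.log_lt_log hR hw,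
        Complex.exp_log hw0⟩
    · rintro ⟨z, hz, rfl⟩
      rw [Complex.norm_exp]
      exact (Real.log_lt_iff_lt_exp hR).1 hz
  rw [h]
  refine IsConnected.image ?_ _ Complex.continuous_exp.continuousOn
  refine ⟨⟨((Real.log R + 1 : ℝ) : ℂ), by simp⟩, ?_⟩
  exact (convex_halfSpace_re_gt (Real.log R)).isPreconnected

/-- The exterior of a large disc is connected and misses `K`, so it lies in a single component of
the complement; every unbounded component meets it and hence is that component. -/
theorem exists_outerComponent_eq {K : Set ℂ} (hK : IsCompact K) :
    ∃ R : ℝ, ∃ p ∈ Kᶜ, (closedBall (0 : ℂ) R)ᶜ ⊆ outerComponent K ∧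
      outerComponent K = connectedComponentIn Kᶜ p := by
  obtain ⟨R₀, hR₀⟩ := hK.isBounded.subset_closedBall 0
  set R := max R₀ 1
  have hR : 0 < R := lt_of_lt_of_le one_pos (le_max_right _ _)
  have hKR : K ⊆ closedBall 0 R := hR₀.trans (closedBall_subset_closedBall (le_max_left _ _))
  have hE := isConnected_compl_closedBall hR
  have hEK : (closedBall (0 : ℂ) R)ᶜ ⊆ Kᶜ := compl_subset_compl.2 hKR
  have hunb : ¬ Bornology.IsBounded (closedBall (0 : ℂ) R)ᶜ := by
    intro h
    have h2 : Bornology.IsBounded (univ : Set ℂ) := by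
      rw [← union_compl_self (closedBall (0 : ℂ) R)]
      exact isBounded_closedBall.union h
    exact NormedSpace.unbounded_univ ℂ ℂ h2
  obtain ⟨p, hp⟩ := hE.nonempty
  have hsub : ∀ q ∈ (closedBall (0 : ℂ) R)ᶜ, (closedBall (0 : ℂ) R)ᶜ ⊆ connectedComponentIn Kᶜ q :=
    fun q hq => hE.isPreconnected.subset_connectedComponentIn hq hEK
  refine ⟨R, p, hEK hp, fun q hq => ⟨hEK hq, fun h => hunb (h.subset (hsub q hq))⟩, ?_⟩
  ext z
  constructor
  · rintro ⟨hz, hb⟩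
    have : ¬ connectedComponentIn Kᶜ z ⊆ closedBall 0 R := fun h =>
      hb (isBounded_closedBall.subset h)
    obtain ⟨q, hq, hqR⟩ := not_subset.1 this
    have h1 := connectedComponentIn_eq hq
    have h2 : p ∈ connectedComponentIn Kᶜ q := hsub q hqR hp
    rw [← connectedComponentIn_eq h2, ← h1]
    exact mem_connectedComponentIn hz
  · intro hz
    refine ⟨connectedComponentIn_subset _ _ hz, fun h => hunb (h.subset ?_)⟩
    rw [← connectedComponentIn_eq hz]
    exact hsub p hp

theorem isConnected_outerComponent {K : Set ℂ} (hK : IsCompact K) :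
    IsConnected (outerComponent K) := by
  obtain ⟨R, p, hp, -, h⟩ := exists_outerComponent_eq hK
  rw [h]
  exact isConnected_connectedComponentIn_iff.2 hp

theorem isOpen_outerComponent {K : Set ℂ} (hK : IsCompact K) : IsOpen (outerComponent K) := by
  obtain ⟨R, p, -, -, h⟩ := exists_outerComponent_eq hK
  rw [h]
  exact hK.isClosed.isOpen_compl.connectedComponentIn

theorem isCompact_filled {K : Set ℂ} (hK : IsCompact K) : IsCompact (filled K) := by
  obtain ⟨R, p, -, h, -⟩ := exists_outerComponent_eq hK
  refine isCompact_of_isClosed_isBounded (isOpen_outerComponent hK).isClosed_compl ?_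
  exact isBounded_closedBall.subset (compl_subset_comm.1 h)

theorem subset_filled (K : Set ℂ) : K ⊆ filled K := fun _ hz h => h.1 hz

theorem connectedComponentIn_subset_filled_diff {K : Set ℂ} {x : ℂ} (hx : x ∈ filled K \ K) :
    connectedComponentIn Kᶜ x ⊆ filled K \ K := by
  intro y hy
  refine ⟨fun h => ?_, connectedComponentIn_subset _ _ hy⟩
  rw [outerComponent, mem_ofPred_eq, ← connectedComponentIn_eq hy] at h
  exact hx.1 ⟨hx.2, h.2⟩

theorem ball_infDist_subset_filled_diff {K : Set ℂ} {x : ℂ} (hx : x ∈ filled K \ K) :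
    ball x (infDist x K) ⊆ filled K \ K := by
  rcases le_or_gt (infDist x K) 0 with h | h
  · rw [ball_eq_empty.2 h]
    exact empty_subset _
  · refine Subset.trans ?_ (connectedComponentIn_subset_filled_diff hx)
    refine (convex_ball x _).isPreconnected.subset_connectedComponentIn (mem_ball_self h) ?_
    exact disjoint_ball_infDist.subset_compl_right

theorem isOpen_filled_diff {K : Set ℂ} (hK : IsCompact K) (hne : K.Nonempty) :
    IsOpen (filled K \ K) := by
  refine Metric.isOpen_iff.2 fun x hx => ⟨infDist x K, ?_, ball_infDist_subset_filled_diff hx⟩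
  exact (hK.isClosed.notMem_iff_infDist_pos hne).1 hx.2

/-- Adjoining one limit point to a connected set keeps it connected, so a limit point off `K`
already belongs to the component. -/
theorem closure_connectedComponentIn_compl_subset {K : Set ℂ} {x : ℂ} (hx : x ∈ Kᶜ) :
    closure (connectedComponentIn Kᶜ x) ⊆ K ∪ connectedComponentIn Kᶜ x := by
  intro y hy
  by_cases hyK : y ∈ K
  · exact Or.inl hyK
  · right
    have hpre : IsPreconnected (insert y (connectedComponentIn Kᶜ x)) :=
      isPreconnected_connectedComponentIn.subset_closure (subset_insert _ _)
        (insert_subset hy subset_closure)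
    exact hpre.subset_connectedComponentIn (mem_insert_of_mem _ (mem_connectedComponentIn hx))
      (insert_subset hyK (connectedComponentIn_subset _ _)) (mem_insert _ _)

/-- The closure of each hole meets `K`: otherwise the hole would be open and closed, hence the whole
plane. So `K` together with that closure is a connected set joining any point of the hole to `K`. -/
theorem isConnected_filled {K : Set ℂ} (hK : IsCompact K) (hc : IsConnected K) :
    IsConnected (filled K) := by
  obtain ⟨k, hk⟩ := hc.nonempty
  refine ⟨⟨k, subset_filled K hk⟩, isPreconnected_of_forall k fun y hy => ?_⟩
  by_cases hyK : y ∈ K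
  · exact ⟨K, subset_filled K, hk, hyK, hc.isPreconnected⟩
  set C := connectedComponentIn Kᶜ y
  have hyC : y ∈ C := mem_connectedComponentIn hyK
  have hCsub : C ⊆ filled K \ K := connectedComponentIn_subset_filled_diff ⟨hy, hyK⟩
  have hcl : closure C ⊆ K ∪ C := closure_connectedComponentIn_compl_subset hyK
  have hmeet : (K ∩ closure C).Nonempty := by
    by_contra hempty
    rw [not_nonempty_iff_eq_empty] at hempty
    have hclosed : closure C = C := by
      refine Subset.antisymm (fun z hz => (hcl hz).resolve_left fun hzK => ?_) subset_closure
      exact (hempty ▸ (⟨hzK, hz⟩ : z ∈ K ∩ closure C) : z ∈ (∅ : Set ℂ))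
    have hclopen : IsClopen C := ⟨closure_eq_iff_isClosed.1 hclosed,
      hK.isClosed.isOpen_compl.connectedComponentIn⟩
    have huniv : C = univ := hclopen.eq_univ ⟨y, hyC⟩
    exact (hCsub (huniv ▸ mem_univ k)).2 hk
  refine ⟨K ∪ closure C, ?_, Or.inl hk, Or.inr (subset_closure hyC), ?_⟩
  · refine union_subset (subset_filled K) (hcl.trans (union_subset (subset_filled K) ?_))
    exact hCsub.trans sdiff_subset
  · exact hc.isPreconnected.union' hmeet isPreconnected_connectedComponentIn.closure

theorem isSimplyConnectedCompact_filled {K : Set ℂ} (hK : IsCompact K) (hc : IsConnected K) :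
    IsSimplyConnectedCompact (filled K) where
  compact := isCompact_filled hK
  connected := isConnected_filled hK hc
  compl_connected := by
    rw [filled, compl_compl]
    exact isConnected_outerComponent hK

end HeleShaw

end

/-! ### The obstacle function: quadratic growth and mean-value Laplacian -/

noncomputable section

namespace HeleShaw

open Metric Filter Topology

theorem volume_real_closedBall (z : ℂ) {R : ℝ} (hR : 0 ≤ R) :
    volume.real (closedBall z R) = Real.pi * R ^ 2 := by
  simp [Measure.real, Complex.volume_closedBall, hR]
  ring

/-- The disc about `x` reaching to `K` stays inside the hole of `x`, so no point outside the holes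
is closer to `x` than `K` is. -/
theorem infDist_le_of_notMem {K : Set ℂ} {z x : ℂ} (hz : z ∉ filled K \ K) (hx : x ∈ filled K \ K) :
    infDist x K ≤ dist x z := by
  by_contra! h
  exact hz (ball_infDist_subset_filled_diff hx (by rwa [mem_ball, dist_comm]))

/-- The function `|z|² - 2 ∫_K log|z - w| dA(w) - u(z) - 2 ∑ bⱼ log|z - aⱼ|`. -/
def obstacle {m : ℕ} (K : Set ℂ) (u : ℂ → ℝ) (a : Fin m → ℂ) (b : Fin m → ℝ) (z : ℂ) : ℝ :=
  ‖z‖ ^ 2 - 2 / Real.pi * logPotential K z - u z - 2 * ∑ j, b j * Real.log ‖z - a j‖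

/-- The obstacle function of `K` vanishes on `K` and is nonnegative at distance less than `ρ`
from `K`, while the points `aⱼ` lie in the holes of `K`, at distance at least `ρ` from `K`. -/
structure SolvesObstacle {m : ℕ} (K : Set ℂ) (u : ℂ → ℝ) (a : Fin m → ℂ) (b : Fin m → ℝ)
    (ρ : ℝ) : Prop where
  compact : IsCompact K
  nonempty : K.Nonempty
  harmonic : InnerProductSpace.HarmonicOnNhd u (filled K)
  mem : ∀ j, a j ∈ filled K \ K
  pos : 0 < ρ
  far : ∀ j, ρ ≤ infDist (a j) K
  harmonic_near : ∀ z, infDist z K < ρ → InnerProductSpace.HarmonicAt u z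
  nonneg : ∀ z, infDist z K < ρ → 0 ≤ obstacle K u a b z
  zero : ∀ z ∈ K, obstacle K u a b z = 0

variable {m : ℕ} {K : Set ℂ} {u : ℂ → ℝ} {a : Fin m → ℂ} {b : Fin m → ℝ} {ρ : ℝ}

theorem integrableOn_obstacle (hK : IsCompact K) {S : Set ℂ} (hS : IsCompact S)
    (hu : ContinuousOn u S) : IntegrableOn (obstacle K u a b) S := by
  have h1 : IntegrableOn (fun z : ℂ => ‖z‖ ^ 2) S :=
    (by fun_prop : Continuous fun z : ℂ => ‖z‖ ^ 2).continuousOn.integrableOn_compact hS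
  have h2 := ((continuous_logPotential hK).continuousOn (s := S)).integrableOn_compact hS
    (μ := volume)
  have h3 : IntegrableOn u S := hu.integrableOn_compact hS
  have h4 : IntegrableOn (fun z => ∑ j, b j * Real.log ‖z - a j‖) S :=
    integrable_finsetSum _ fun j _ => (integrableOn_log_norm_sub (a j) hS.isBounded).const_mul _
  exact ((h1.sub (h2.const_mul _)).sub h3).sub (h4.const_mul _)

theorem integral_closedBall_obstacle (hK : IsCompact K) {z : ℂ} {R : ℝ} (hR : 0 < R)
    (hu : InnerProductSpace.HarmonicOnNhd u (closedBall z R)) :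
    ∫ x in closedBall z R, obstacle K u a b x =
      Real.pi * R ^ 2 * obstacle K u a b z + Real.pi * R ^ 4 / 2 -
        2 / Real.pi * (∫ w in K, logExcess R (z - w)) -
        2 * ∑ j, b j * logExcess R (z - a j) := by
  have hS := isCompact_closedBall z R
  have h1 : IntegrableOn (fun z : ℂ => ‖z‖ ^ 2) (closedBall z R) :=
    (by fun_prop : Continuous fun z : ℂ => ‖z‖ ^ 2).continuousOn.integrableOn_compact hS
  have h2 := ((continuous_logPotential hK).continuousOn
    (s := closedBall z R)).integrableOn_compact hS (μ := volume)
  have h3 : IntegrableOn u (closedBall z R) := hu.continuousOn.integrableOn_compact hS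
  have h4 : ∀ j ∈ Finset.univ, IntegrableOn (fun z => b j * Real.log ‖z - a j‖) (closedBall z R) :=
    fun j _ => (integrableOn_log_norm_sub (a j) hS.isBounded).const_mul _
  have h4' : IntegrableOn (fun z => ∑ j, b j * Real.log ‖z - a j‖) (closedBall z R) :=
    integrable_finsetSum _ h4
  have h12 : IntegrableOn (fun z => ‖z‖ ^ 2 - 2 / Real.pi * logPotential K z) (closedBall z R) :=
    h1.sub (h2.const_mul _)
  have h123 : IntegrableOn (fun z => ‖z‖ ^ 2 - 2 / Real.pi * logPotential K z - u z)
      (closedBall z R) := h12.sub h3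
  unfold obstacle
  rw [integral_sub h123 (h4'.const_mul _), integral_sub h12 h3, integral_sub h1 (h2.const_mul _),
    integral_const_mul, integral_const_mul, integral_finsetSum _ h4,
    integral_closedBall_norm_sq z hR.le, integral_closedBall_logPotential hK z hR,
    integral_closedBall_harmonic hR.le hu]
  simp only [integral_const_mul, integral_closedBall_log _ _ hR]
  have e : ∑ j, b j * (Real.pi * R ^ 2 * Real.log ‖z - a j‖ + logExcess R (z - a j)) =
      Real.pi * R ^ 2 * (∑ j, b j * Real.log ‖z - a j‖) + ∑ j, b j * logExcess R (z - a j) := by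
    rw [Finset.mul_sum, ← Finset.sum_add_distrib]
    exact Finset.sum_congr rfl fun j _ => by ring
  rw [e]
  ring

/-- The obstacle function cut off outside the holes of `K`. -/
def holeObstacle {m : ℕ} (K : Set ℂ) (u : ℂ → ℝ) (a : Fin m → ℂ) (b : Fin m → ℝ) : ℂ → ℝ :=
  (filled K \ K).indicator (obstacle K u a b)

namespace SolvesObstacle

variable (hs : SolvesObstacle K u a b ρ)

include hs

theorem dist_ge {z : ℂ} {R : ℝ} (hz : infDist z K ≤ R) (hR : 2 * R ≤ ρ) (j : Fin m) :
    R ≤ ‖z - a j‖ := by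
  have h1 := infDist_le_infDist_add_dist (x := a j) (y := z) (s := K)
  rw [dist_comm, dist_eq_norm] at h1
  linarith [hs.far j]

theorem isOpen_holes : IsOpen (filled K \ K) := isOpen_filled_diff hs.compact hs.nonempty

theorem infDist_pos {z : ℂ} (hz : z ∈ filled K \ K) : 0 < infDist z K :=
  (hs.compact.isClosed.notMem_iff_infDist_pos hs.nonempty).1 hz.2

/-- Let `d` be the distance to `K` and `z` a nearest point of `K`. Positivity lets the integral over
the disc of radius `d` about `x` be bounded by that over the disc of radius `2d` about `z`. The
first is `π d² Φ(x) + π d⁴ / 2`, since the charges and the interior of `K` are not reached; the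
second is at most `π (2d)⁴ / 2 = 8 π d⁴`, since `Φ(z) = 0` and the mass on `K` only lowers it. No
regularity of the boundary enters. -/
theorem le_sq_infDist {x : ℂ} (hx : x ∈ filled K \ K) (hd : 4 * infDist x K ≤ ρ) :
    obstacle K u a b x ≤ 8 * infDist x K ^ 2 := by
  set d := infDist x K with hdd
  have hd0 : 0 < d := hs.infDist_pos hx
  obtain ⟨z, hz, hdz⟩ := hs.compact.exists_infDist_eq_dist hs.nonempty x
  rw [← hdd] at hdz
  have hnear : ∀ y ∈ closedBall z (2 * d), infDist y K < ρ := fun y hy =>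
    (infDist_le_dist_of_mem hz).trans_lt (by rw [mem_closedBall] at hy; linarith)
  have hsub : closedBall x d ⊆ closedBall z (2 * d) :=
    closedBall_subset_closedBall' (by linarith)
  have hharm : InnerProductSpace.HarmonicOnNhd u (closedBall z (2 * d)) := fun y hy =>
    hs.harmonic_near y (hnear y hy)
  have e1 := integral_closedBall_obstacle (a := a) (b := b) hs.compact hd0 (hharm.mono hsub)
  have e2 := integral_closedBall_obstacle (a := a) (b := b) hs.compact
    (by positivity : 0 < 2 * d) hharm
  have s1 : ∑ j, b j * logExcess d (x - a j) = 0 := Finset.sum_eq_zero fun j _ => by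
    rw [logExcess_eq_zero (hs.dist_ge hdd.ge (by linarith) j), mul_zero]
  have s2 : ∑ j, b j * logExcess (2 * d) (z - a j) = 0 := Finset.sum_eq_zero fun j _ => by
    rw [logExcess_eq_zero (hs.dist_ge (by rw [infDist_zero_of_mem hz]; linarith)
      (by linarith) j), mul_zero]
  have s3 : ∫ w in K, logExcess d (x - w) = 0 := setIntegral_logExcess_eq_zero fun w hw => by
    rw [← dist_eq_norm]; exact infDist_le_dist_of_mem hw
  have s4 := setIntegral_logExcess_nonneg K z (2 * d)
  have hmono : ∫ y in closedBall x d, obstacle K u a b y ≤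
      ∫ y in closedBall z (2 * d), obstacle K u a b y := by
    refine setIntegral_mono_set (integrableOn_obstacle hs.compact (isCompact_closedBall _ _)
      hharm.continuousOn) ?_ hsub.eventuallyLE
    filter_upwards [ae_restrict_mem measurableSet_closedBall] with y hy
    exact hs.nonneg y (hnear y hy)
  rw [e1, e2, s1, s2, s3, hs.zero z hz] at hmono
  have hpi := Real.pi_pos
  have h6 : 0 ≤ 2 / Real.pi * ∫ w in K, logExcess (2 * d) (z - w) := by positivity
  have h7 : Real.pi * d ^ 2 * obstacle K u a b x ≤ Real.pi * d ^ 2 * (8 * d ^ 2) := by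
    nlinarith [mul_pos hpi (pow_pos hd0 4)]
  exact le_of_mul_le_mul_left h7 (by positivity)

theorem holeObstacle_bound {x : ℂ} {r : ℝ} (hr : 4 * r ≤ ρ)
    (hx : x ∈ filled K \ K → infDist x K ≤ r) :
    ‖holeObstacle K u a b x‖ ≤ (filled K \ K).indicator (fun _ => 8 * r ^ 2) x := by
  unfold holeObstacle
  by_cases h : x ∈ filled K \ K
  · have h1 := hx h
    have h0 := hs.infDist_pos h
    rw [indicator_of_mem h, indicator_of_mem h, Real.norm_of_nonneg (hs.nonneg x (by linarith))]
    refine (hs.le_sq_infDist h (by linarith)).trans ?_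
    gcongr
  · simp [indicator_of_notMem h]

theorem integrable_holeObstacle : Integrable (holeObstacle K u a b) := by
  refine (integrable_indicator_iff hs.isOpen_holes.measurableSet).2 ?_
  exact (integrableOn_obstacle hs.compact (isCompact_filled hs.compact)
    hs.harmonic.continuousOn).mono_set sdiff_subset

theorem continuousAt_obstacle {z : ℂ} (hz : z ∈ filled K) (hza : ∀ j, z ≠ a j) :
    ContinuousAt (obstacle K u a b) z := by
  have h1 := (continuous_logPotential hs.compact).continuousAt (x := z)
  have h2 := (hs.harmonic z hz).1.continuousAt
  have h3 : ∀ j, ContinuousAt (fun z => Real.log ‖z - a j‖) z := fun j =>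
    ContinuousAt.log (by fun_prop) (norm_ne_zero_iff.2 (sub_ne_zero.2 (hza j)))
  unfold obstacle
  fun_prop

/-- Cutting off creates no jump, because the obstacle function is continuous and zero at the points
of `K` and the holes have no boundary elsewhere. -/
theorem continuousAt_holeObstacle {z : ℂ} (hza : ∀ j, z ≠ a j) :
    ContinuousAt (holeObstacle K u a b) z := by
  by_cases hzf : z ∈ filled K
  · by_cases hzK : z ∈ K
    · have hc := hs.continuousAt_obstacle hzf hza
      have h0 : holeObstacle K u a b z = 0 := indicator_of_notMem (fun h => h.2 hzK) _
      rw [ContinuousAt, hs.zero z hzK] at hc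
      rw [ContinuousAt, h0]
      refine squeeze_zero_norm (fun x => ?_) (tendsto_zero_iff_norm_tendsto_zero.1 hc)
      exact norm_indicator_le_norm_self _ _
    · refine (hs.continuousAt_obstacle hzf hza).congr ?_
      filter_upwards [hs.isOpen_holes.mem_nhds ⟨hzf, hzK⟩] with x hx
      exact (indicator_of_mem hx _).symm
  · have : holeObstacle K u a b =ᶠ[𝓝 z] fun _ => 0 := by
      filter_upwards [(isCompact_filled hs.compact).isClosed.isOpen_compl.mem_nhds hzf] with x hx
      exact indicator_of_notMem (fun h => hx h.1) _
    exact continuousAt_const.congr this.symm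

end SolvesObstacle

/-- The mean-value approximation of the Laplacian of the cut-off obstacle function, with the
point masses at the `aⱼ` removed. -/
def meanLaplacian {m : ℕ} (K : Set ℂ) (u : ℂ → ℝ) (a : Fin m → ℂ) (b : Fin m → ℝ) (R : ℝ)
    (z : ℂ) : ℝ :=
  8 / (Real.pi * R ^ 4) * (∫ x in closedBall z R, holeObstacle K u a b x) -
    8 / R ^ 2 * holeObstacle K u a b z +
    2 * ∑ j, b j * (8 / (Real.pi * R ^ 4) * logExcess R (z - a j))

namespace SolvesObstacle

variable (hs : SolvesObstacle K u a b ρ)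

include hs

/-- For smooth `f` the disc integral exceeds `π R² f(z)` by `π R⁴ Δf(z) / 8` to leading order,
whence the factor `8 / (π R⁴)`. Here the identity is exact: disc means of the squared norm, of
harmonic functions and of logarithms are explicit, the disc avoids the mass on `K`, and the excesses
of the charges cancel. -/
theorem meanLaplacian_eq_four {z : ℂ} {R : ℝ} (hR : 0 < R) (hz : z ∈ filled K \ K)
    (hd : R < infDist z K) : meanLaplacian K u a b R z = 4 := by
  have hsub : closedBall z R ⊆ filled K \ K :=
    (closedBall_subset_ball hd).trans (ball_infDist_subset_filled_diff hz)
  have hint : ∫ x in closedBall z R, holeObstacle K u a b x =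
      ∫ x in closedBall z R, obstacle K u a b x :=
    setIntegral_congr_fun measurableSet_closedBall fun x hx => indicator_of_mem (hsub hx) _
  have s3 : ∫ w in K, logExcess R (z - w) = 0 := setIntegral_logExcess_eq_zero fun w hw => by
    rw [← dist_eq_norm]; exact hd.le.trans (infDist_le_dist_of_mem hw)
  have hpi := Real.pi_pos
  have e : ∑ j, b j * (8 / (Real.pi * R ^ 4) * logExcess R (z - a j)) =
      8 / (Real.pi * R ^ 4) * ∑ j, b j * logExcess R (z - a j) := by
    rw [Finset.mul_sum]
    exact Finset.sum_congr rfl fun j _ => by ring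
  rw [meanLaplacian, hint, integral_closedBall_obstacle hs.compact hR
    (hs.harmonic.mono (hsub.trans sdiff_subset)), s3, holeObstacle, indicator_of_mem hz, e]
  field_simp
  ring

theorem meanLaplacian_eq_of_near {z : ℂ} {R : ℝ} (hR : 2 * R ≤ ρ) (hR0 : 0 < R)
    (hz : z ∈ filled K \ K → infDist z K ≤ R) :
    meanLaplacian K u a b R z = 8 / (Real.pi * R ^ 4) *
      (∫ x in closedBall z R, holeObstacle K u a b x) - 8 / R ^ 2 * holeObstacle K u a b z := by
  have s1 : ∑ j, b j * (8 / (Real.pi * R ^ 4) * logExcess R (z - a j)) = 0 :=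
    Finset.sum_eq_zero fun j _ => by
      have : R ≤ ‖z - a j‖ := by
        by_cases h : z ∈ filled K \ K
        · exact hs.dist_ge (hz h) hR j
        · have := infDist_le_of_notMem h (hs.mem j)
          rw [dist_comm, dist_eq_norm] at this
          linarith [hs.far j]
      rw [logExcess_eq_zero this, mul_zero, mul_zero]
  rw [meanLaplacian, s1]
  ring

theorem norm_integral_holeObstacle_le {z : ℂ} {R r : ℝ} (hr : 4 * r ≤ ρ)
    (h : ∀ x ∈ closedBall z R, x ∈ filled K \ K → infDist x K ≤ r) :
    ‖∫ x in closedBall z R, holeObstacle K u a b x‖ ≤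
      8 * r ^ 2 * volume.real ((filled K \ K) ∩ closedBall z R) := by
  have hb : ∀ x ∈ closedBall z R, ‖holeObstacle K u a b x‖ ≤
      (filled K \ K).indicator (fun _ => 8 * r ^ 2) x := fun x hx =>
    hs.holeObstacle_bound hr (h x hx)
  have hm := hs.isOpen_holes.measurableSet
  have hi : IntegrableOn ((filled K \ K).indicator fun _ => 8 * r ^ 2) (closedBall z R) := by
    refine Integrable.indicator ?_ hm
    exact integrableOn_const isBounded_closedBall.measure_lt_top.ne
  calc _ ≤ ∫ x in closedBall z R, (filled K \ K).indicator (fun _ => 8 * r ^ 2) x := by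
        refine norm_integral_le_of_norm_le hi ?_
        filter_upwards [ae_restrict_mem measurableSet_closedBall] with x hx using hb x hx
    _ = 8 * r ^ 2 * volume.real ((filled K \ K) ∩ closedBall z R) := by
        rw [setIntegral_indicator hm, setIntegral_const, inter_comm, smul_eq_mul, mul_comm]

/-- Deep inside a hole the value is `4`. Elsewhere quadratic growth makes the disc integral `O(R⁴)`
and the central value `O(R²)`. This uniform bound serves for dominated convergence. -/
theorem norm_meanLaplacian_le {R : ℝ} (hR : 0 < R) (hRρ : 8 * R ≤ ρ) (z : ℂ) :
    ‖meanLaplacian K u a b R z‖ ≤ 512 := by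
  by_cases hz : z ∈ filled K \ K ∧ R < infDist z K
  · rw [hs.meanLaplacian_eq_four hR hz.1 hz.2]
    norm_num
  have hz' : z ∈ filled K \ K → infDist z K ≤ R := fun h => not_lt.1 fun h2 => hz ⟨h, h2⟩
  rw [hs.meanLaplacian_eq_of_near (by linarith) hR hz']
  -- A hole point within `R` of `z` has distance at most `2R` from `K`, whether `z` is a hole point
  -- at distance at most `R` from `K` or lies outside the holes.
  have h1 := hs.norm_integral_holeObstacle_le (z := z) (R := R) (r := 2 * R) (by linarith)
    (fun x hx hxW => by
      by_cases h : z ∈ filled K \ K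
      · have := infDist_le_infDist_add_dist (x := x) (y := z) (s := K)
        rw [mem_closedBall] at hx
        linarith [hz' h]
      · have := infDist_le_of_notMem h hxW
        rw [mem_closedBall] at hx
        linarith)
  have h2 : volume.real ((filled K \ K) ∩ closedBall z R) ≤ Real.pi * R ^ 2 := by
    rw [← volume_real_closedBall z hR.le]
    exact measureReal_mono inter_subset_right isBounded_closedBall.measure_lt_top.ne
  have h3 : ‖holeObstacle K u a b z‖ ≤ 8 * R ^ 2 :=
    (hs.holeObstacle_bound (r := R) (by linarith) hz').trans
      (indicator_le_self' (fun _ _ => by positivity) _)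
  have hpi := Real.pi_pos
  calc _ ≤ ‖8 / (Real.pi * R ^ 4) * ∫ x in closedBall z R, holeObstacle K u a b x‖ +
        ‖8 / R ^ 2 * holeObstacle K u a b z‖ := norm_sub_le _ _
    _ ≤ 8 / (Real.pi * R ^ 4) * (8 * (2 * R) ^ 2 * (Real.pi * R ^ 2)) +
        8 / R ^ 2 * (8 * R ^ 2) := by
        rw [norm_mul, norm_mul, Real.norm_of_nonneg (by positivity : 0 ≤ 8 / (Real.pi * R ^ 4)),
          Real.norm_of_nonneg (by positivity : 0 ≤ 8 / R ^ 2)]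
        gcongr
        exact h1.trans (by gcongr)
    _ ≤ 512 := by
        field_simp
        norm_num

/-- At a point outside the holes the quotient is at most `64` times the proportion of the disc
filled by holes, which tends to `0` almost everywhere by the Lebesgue density theorem. So even a
boundary of positive area contributes nothing. -/
theorem tendsto_meanLaplacian :
    ∀ᵐ z : ℂ, Tendsto (fun R => meanLaplacian K u a b R z) (𝓝[>] 0)
      (𝓝 ((filled K \ K).indicator (fun _ => 4) z)) := by
  filter_upwards [Besicovitch.ae_tendsto_measure_inter_div_of_measurableSet volume
    hs.isOpen_holes.measurableSet] with z hz
  by_cases hzW : z ∈ filled K \ K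
  · rw [indicator_of_mem hzW]
    refine tendsto_const_nhds.congr' ?_
    filter_upwards [Ioo_mem_nhdsGT (hs.infDist_pos hzW)] with R hR
    exact (hs.meanLaplacian_eq_four hR.1 hzW hR.2).symm
  · rw [indicator_of_notMem hzW] at hz ⊢
    have h1 : Tendsto (fun R => 64 * (volume ((filled K \ K) ∩ closedBall z R) /
        volume (closedBall z R)).toReal) (𝓝[>] 0) (𝓝 0) := by
      have := ((ENNReal.tendsto_toReal ENNReal.zero_ne_top).comp hz).const_mul 64
      simpa using this
    refine squeeze_zero_norm' ?_ h1
    filter_upwards [Ioo_mem_nhdsGT (show 0 < ρ / 4 by linarith [hs.pos])] with R hR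
    have hR0 := hR.1
    have hRρ : 4 * R ≤ ρ := by linarith [hR.2]
    have h2 := hs.norm_integral_holeObstacle_le (z := z) (R := R) (r := R) hRρ fun x hx hxW =>
      (infDist_le_of_notMem hzW hxW).trans hx
    have hpi := Real.pi_pos
    have hz0 : holeObstacle K u a b z = 0 := indicator_of_notMem hzW _
    rw [hs.meanLaplacian_eq_of_near (by linarith) hR0 (fun h => absurd h hzW),
      hz0, mul_zero, sub_zero, norm_mul,
      Real.norm_of_nonneg (by positivity : 0 ≤ 8 / (Real.pi * R ^ 4)), ENNReal.toReal_div]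
    change _ ≤ 64 * (volume.real _ / volume.real _)
    rw [volume_real_closedBall z hR0.le]
    calc _ ≤ 8 / (Real.pi * R ^ 4) *
          (8 * R ^ 2 * volume.real ((filled K \ K) ∩ closedBall z R)) := by gcongr
      _ = _ := by field_simp; ring

end SolvesObstacle

end HeleShaw

end

/-! ### The weak Laplace identity, the area of the holes and the potential representation -/

noncomputable section

namespace HeleShaw

open Metric Filter Topology

theorem integrable_integral_closedBall_mul {u ψ : ℂ → ℝ} (hu : Integrable u) (hψ : Integrable ψ)
    (R : ℝ) : Integrable fun z => (∫ x in closedBall z R, u x) * ψ z := by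
  have hset : MeasurableSet {p : ℂ × ℂ | dist p.1 p.2 ≤ R} :=
    measurableSet_le (by fun_prop) measurable_const
  have hint : Integrable ({p : ℂ × ℂ | dist p.1 p.2 ≤ R}.indicator fun p => ψ p.1 * u p.2)
      (volume.prod volume) := (hψ.mul_prod hu).indicator hset
  refine hint.integral_prod_left.congr (Eventually.of_forall fun z => ?_)
  simp only
  rw [mul_comm, ← integral_const_mul, ← integral_indicator measurableSet_closedBall]
  congr 1
  ext x
  simp only [indicator, mem_ofPred_eq, mem_closedBall, dist_comm]

theorem eventually_integrable_logExcess_mul {v : ℂ → ℝ} {z : ℂ} (hv : ContinuousAt v z)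
    (hm : AEStronglyMeasurable v) :
    ∀ᶠ R in 𝓝[>] (0 : ℝ), Integrable fun w => logExcess R (w - z) * v w := by
  obtain ⟨δ, hδ, hδv⟩ := Metric.continuousAt_iff.1 hv 1 one_pos
  filter_upwards [Ioo_mem_nhdsGT hδ] with R hR
  have hi : Integrable fun w => logExcess R (w - z) := (integrable_logExcess R).comp_sub_right z
  refine (hi.norm.mul_const (|v z| + 1)).mono' (hi.aestronglyMeasurable.mul hm)
    (Eventually.of_forall fun w => ?_)
  rw [norm_mul]
  by_cases h : R ≤ ‖w - z‖
  · simp [logExcess_eq_zero h]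
  · refine mul_le_mul_of_nonneg_left ?_ (norm_nonneg _)
    have h1 : dist w z < δ := by rw [dist_eq_norm]; linarith [hR.2]
    have h2 := hδv h1
    rw [Real.dist_eq] at h2
    have h3 := abs_sub_abs_le_abs_sub (v w) (v z)
    rw [Real.norm_eq_abs]
    linarith

variable {m : ℕ} {K : Set ℂ} {u : ℂ → ℝ} {a : Fin m → ℂ} {b : Fin m → ℝ} {ρ : ℝ}

namespace SolvesObstacle

variable (hs : SolvesObstacle K u a b ρ)

include hs

/-- Weak form of the identity for the Laplacian of the cut-off obstacle function. -/
theorem tendsto_integral_holeObstacle_mul {ψ : ℂ → ℝ} (hψ : Integrable ψ)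
    (hψa : ∀ j, ContinuousAt ψ (a j)) (hint : Integrable fun z => holeObstacle K u a b z * ψ z) :
    Tendsto (fun R : ℝ => ∫ x, holeObstacle K u a b x *
        (8 / (Real.pi * R ^ 4) * (∫ z in closedBall x R, ψ z) - 8 / R ^ 2 * ψ x)) (𝓝[>] 0)
      (𝓝 (4 * (∫ z in filled K \ K, ψ z) - 4 * Real.pi * ∑ j, b j * ψ (a j))) := by
  have hH := hs.integrable_holeObstacle
  have hL : ∀ᶠ R in 𝓝[>] (0 : ℝ), ∀ j, Integrable fun w => logExcess R (w - a j) * ψ w :=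
    eventually_all.2 fun j =>
      eventually_integrable_logExcess_mul (hψa j) hψ.aestronglyMeasurable
  -- Disc averaging is symmetric, so the difference quotient passes from `ψ` to the cut-off obstacle
  -- function; the charge terms added in `meanLaplacian` are subtracted again.
  have hML : ∀ R : ℝ, (∀ j, Integrable fun w => logExcess R (w - a j) * ψ w) →
      Integrable (fun z => meanLaplacian K u a b R z * ψ z) ∧
      ∫ x, holeObstacle K u a b x *
        (8 / (Real.pi * R ^ 4) * (∫ z in closedBall x R, ψ z) - 8 / R ^ 2 * ψ x) =
      (∫ z, meanLaplacian K u a b R z * ψ z) -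
        2 * ∑ j, b j * (8 / (Real.pi * R ^ 4) * ∫ w, logExcess R (w - a j) * ψ w) := by
    intro R hR
    set k := 8 / (Real.pi * R ^ 4)
    have i1 := (integrable_integral_closedBall_mul hH hψ R).const_mul k
    have i2 := hint.const_mul (8 / R ^ 2)
    have i3 : ∀ j ∈ Finset.univ, Integrable fun z => b j * (k * (logExcess R (z - a j) * ψ z)) :=
      fun j _ => ((hR j).const_mul k).const_mul (b j)
    have i3' : Integrable fun z => 2 * ∑ j, b j * (k * (logExcess R (z - a j) * ψ z)) :=
      (integrable_finsetSum _ i3).const_mul 2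
    have i4 := (integrable_integral_closedBall_mul hψ hH R).const_mul k
    have i12 : Integrable fun z => k * ((∫ x in closedBall z R, holeObstacle K u a b x) * ψ z) -
        8 / R ^ 2 * (holeObstacle K u a b z * ψ z) := i1.sub i2
    have e : (fun z => meanLaplacian K u a b R z * ψ z) = fun z =>
        k * ((∫ x in closedBall z R, holeObstacle K u a b x) * ψ z) -
        8 / R ^ 2 * (holeObstacle K u a b z * ψ z) +
        2 * ∑ j, b j * (k * (logExcess R (z - a j) * ψ z)) := by
      ext z
      have : ∑ j, b j * (k * (logExcess R (z - a j) * ψ z)) =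
          (∑ j, b j * (k * logExcess R (z - a j))) * ψ z := by
        rw [Finset.sum_mul]
        exact Finset.sum_congr rfl fun j _ => by ring
      rw [meanLaplacian, this]
      ring
    refine ⟨e ▸ i12.add i3', ?_⟩
    rw [e, integral_add i12 i3', integral_sub i1 i2, integral_const_mul, integral_const_mul,
      integral_const_mul, integral_finsetSum _ i3, integral_closedBall_mul_comm hH hψ]
    simp only [integral_const_mul]
    rw [add_sub_cancel_right, ← integral_const_mul, ← integral_const_mul, ← integral_sub]
    · congr 1
      ext x
      ring
    · exact i4.congr (Eventually.of_forall fun x => by simp only; ring)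
    · exact i2
  have hlim1 : Tendsto (fun R : ℝ => ∫ z, meanLaplacian K u a b R z * ψ z) (𝓝[>] 0)
      (𝓝 (4 * ∫ z in filled K \ K, ψ z)) := by
    have e : 4 * ∫ z in filled K \ K, ψ z =
        ∫ z, (filled K \ K).indicator (fun _ => (4 : ℝ)) z * ψ z := by
      rw [← integral_const_mul, ← integral_indicator hs.isOpen_holes.measurableSet]
      congr 1
      ext z
      simp only [indicator]
      split_ifs <;> simp
    rw [e]
    refine tendsto_integral_filter_of_dominated_convergence (fun z => 512 * ‖ψ z‖) ?_ ?_
      (hψ.norm.const_mul _) ?_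
    · filter_upwards [hL] with R hR using (hML R hR).1.aestronglyMeasurable
    · filter_upwards [Ioo_mem_nhdsGT (show 0 < ρ / 8 by linarith [hs.pos])] with R hR
      refine Eventually.of_forall fun z => ?_
      rw [norm_mul]
      exact mul_le_mul_of_nonneg_right
        (hs.norm_meanLaplacian_le hR.1 (by linarith [hR.2]) z) (norm_nonneg _)
    · filter_upwards [hs.tendsto_meanLaplacian] with z hz using hz.mul_const _
  have hlim2 : Tendsto (fun R : ℝ => 2 * ∑ j, b j * (8 / (Real.pi * R ^ 4) *
      ∫ w, logExcess R (w - a j) * ψ w)) (𝓝[>] 0) (𝓝 (4 * Real.pi * ∑ j, b j * ψ (a j))) := by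
    have e : 4 * Real.pi * ∑ j, b j * ψ (a j) = 2 * ∑ j, b j * (2 * Real.pi * ψ (a j)) := by
      rw [Finset.mul_sum, Finset.mul_sum]
      exact Finset.sum_congr rfl fun j _ => by ring
    rw [e]
    exact (tendsto_finsetSum _ fun j _ => (tendsto_integral_logExcess_mul (hψa j)
      hψ.aestronglyMeasurable).const_mul (b j)).const_mul 2
  refine (hlim1.sub hlim2).congr' ?_
  filter_upwards [hL] with R hR using ((hML R hR).2).symm

theorem exists_isBounded_nhds (z₀ : ℂ) : ∃ D : ℝ, z₀ ∈ ball (0 : ℂ) D ∧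
    ∀ x ∈ filled K, closedBall x 1 ⊆ ball (0 : ℂ) D := by
  obtain ⟨D, hD⟩ := (isCompact_filled hs.compact).isBounded.subset_ball 0
  refine ⟨max (D + 1) (‖z₀‖ + 1), ?_, fun x hx y hy => ?_⟩
  · rw [mem_ball_zero_iff]
    exact lt_of_lt_of_le (lt_add_one _) (le_max_right _ _)
  · have h1 := hD hx
    rw [mem_ball_zero_iff] at h1 ⊢
    rw [mem_closedBall, dist_eq_norm] at hy
    have := norm_le_norm_add_norm_sub' y x
    exact lt_of_lt_of_le (by linarith) (le_max_left _ _)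

/-- The area of the holes is determined by the point charges. -/
theorem volume_holes : volume.real (filled K \ K) = Real.pi * ∑ j, b j := by
  obtain ⟨D, -, hD⟩ := hs.exists_isBounded_nhds 0
  -- The test function is constant on a neighbourhood of the filled set, so for `R < 1` its
  -- difference quotient vanishes wherever the cut-off obstacle function does not.
  set ψ : ℂ → ℝ := (ball (0 : ℂ) D).indicator fun _ => 1
  have hψ1 : ∀ x ∈ ball (0 : ℂ) D, ψ x = 1 := fun x hx => indicator_of_mem hx _
  have hin : ∀ x ∈ filled K, x ∈ ball (0 : ℂ) D := fun x hx =>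
    hD x hx (mem_closedBall_self zero_le_one)
  have hψ : Integrable ψ := (integrable_indicator_iff measurableSet_ball).2
    (integrableOn_const isBounded_ball.measure_lt_top.ne)
  have hprod : (fun z => holeObstacle K u a b z * ψ z) = holeObstacle K u a b := by
    ext z
    by_cases hz : z ∈ filled K \ K
    · rw [hψ1 z (hin z hz.1), mul_one]
    · simp [holeObstacle, indicator_of_notMem hz]
  have h := hs.tendsto_integral_holeObstacle_mul hψ (fun j => by
      have : ψ =ᶠ[𝓝 (a j)] fun _ => 1 := by
        filter_upwards [isOpen_ball.mem_nhds (hin _ (hs.mem j).1)] with x hx using hψ1 x hx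
      exact continuousAt_const.congr this.symm) (by rw [hprod]; exact hs.integrable_holeObstacle)
  have h0 : Tendsto (fun R : ℝ => ∫ x, holeObstacle K u a b x *
      (8 / (Real.pi * R ^ 4) * (∫ z in closedBall x R, ψ z) - 8 / R ^ 2 * ψ x)) (𝓝[>] 0)
      (𝓝 0) := by
    refine tendsto_const_nhds.congr' ?_
    filter_upwards [Ioo_mem_nhdsGT one_pos] with R hR
    refine (integral_eq_zero_of_ae (Eventually.of_forall fun x => ?_)).symm
    by_cases hx : x ∈ filled K \ K
    · have e : ∫ z in closedBall x R, ψ z = Real.pi * R ^ 2 := by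
        rw [setIntegral_congr_fun measurableSet_closedBall (g := fun _ => 1) fun z hz =>
          hψ1 z (hD x hx.1 (closedBall_subset_closedBall hR.2.le hz))]
        simp [volume_real_closedBall x hR.1.le]
      have hR0 := hR.1
      have hpi := Real.pi_pos
      rw [e, hψ1 x (hin x hx.1)]
      simp only [Pi.zero_apply, mul_eq_zero]
      right
      field_simp
      ring
    · simp [holeObstacle, indicator_of_notMem hx]
  have huniq := tendsto_nhds_unique h h0
  have e1 : ∫ z in filled K \ K, ψ z = volume.real (filled K \ K) := by
    rw [setIntegral_congr_fun hs.isOpen_holes.measurableSet (g := fun _ => 1) fun z hz =>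
      hψ1 z (hin z hz.1)]
    simp
  have e2 : ∑ j, b j * ψ (a j) = ∑ j, b j :=
    Finset.sum_congr rfl fun j _ => by rw [hψ1 _ (hin _ (hs.mem j).1), mul_one]
  rw [e1, e2] at huniq
  linarith

/-- The logarithmic potential representation of the cut-off obstacle function. -/
theorem holeObstacle_eq {z₀ : ℂ} (hz₀ : ∀ j, z₀ ≠ a j) :
    holeObstacle K u a b z₀ =
      2 / Real.pi * logPotential (filled K \ K) z₀ - 2 * ∑ j, b j * Real.log ‖z₀ - a j‖ := by
  obtain ⟨D, hz₀D, hD⟩ := hs.exists_isBounded_nhds z₀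
  set ψ : ℂ → ℝ := (ball (0 : ℂ) D).indicator fun x => Real.log ‖x - z₀‖ with hψdef
  have hψ1 : ∀ x ∈ ball (0 : ℂ) D, ψ x = Real.log ‖x - z₀‖ := fun x hx => indicator_of_mem hx _
  have hin : ∀ x ∈ filled K, x ∈ ball (0 : ℂ) D := fun x hx =>
    hD x hx (mem_closedBall_self zero_le_one)
  have hψ : Integrable ψ := (integrable_indicator_iff measurableSet_ball).2
    (integrableOn_log_norm_sub z₀ isBounded_ball)
  have hH := hs.integrable_holeObstacle
  have hcont := hs.continuousAt_holeObstacle hz₀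
  -- The two factors are never singular together: near `z₀` the cut-off obstacle function is bounded
  -- by continuity, and away from `z₀` the truncated logarithm is bounded.
  have hprod : Integrable fun z => holeObstacle K u a b z * ψ z := by
    obtain ⟨δ, hδ, hδv⟩ := Metric.continuousAt_iff.1 hcont 1 one_pos
    have hm : AEStronglyMeasurable (fun z => holeObstacle K u a b z * ψ z) :=
      hH.aestronglyMeasurable.mul hψ.aestronglyMeasurable
    have hD0 : 0 < D := by
      rw [mem_ball_zero_iff] at hz₀D
      exact (norm_nonneg _).trans_lt hz₀D
    set M := |Real.log δ| + |Real.log (2 * D)|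
    refine ((hψ.norm.const_mul (‖holeObstacle K u a b z₀‖ + 1)).add
      (hH.norm.mul_const M)).mono' hm (Eventually.of_forall fun x => ?_)
    rw [norm_mul]
    by_cases hx : dist x z₀ < δ
    · have h2 := hδv hx
      rw [dist_eq_norm] at h2
      have h3 := norm_le_norm_add_norm_sub' (holeObstacle K u a b x) (holeObstacle K u a b z₀)
      have h4 : ‖holeObstacle K u a b x‖ * ‖ψ x‖ ≤
          (‖holeObstacle K u a b z₀‖ + 1) * ‖ψ x‖ := by gcongr; linarith
      exact h4.trans (le_add_of_nonneg_right (by positivity))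
    · have h4 : ‖ψ x‖ ≤ M := by
        by_cases hxD : x ∈ ball (0 : ℂ) D
        · rw [hψ1 x hxD, Real.norm_eq_abs]
          rw [not_lt, dist_eq_norm] at hx
          have h5 : ‖x - z₀‖ ≤ 2 * D := by
            rw [mem_ball_zero_iff] at hxD hz₀D
            linarith [norm_sub_le x z₀]
          have h6 := Real.log_le_log hδ hx
          have h7 := Real.log_le_log (hδ.trans_le hx) h5
          rw [abs_le]
          constructor
          · linarith [neg_abs_le (Real.log δ), abs_nonneg (Real.log (2 * D))]
          · linarith [le_abs_self (Real.log (2 * D)), abs_nonneg (Real.log δ)]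
        · rw [hψdef, indicator_of_notMem hxD, norm_zero]
          positivity
      have h5 : ‖holeObstacle K u a b x‖ * ‖ψ x‖ ≤ ‖holeObstacle K u a b x‖ * M := by gcongr
      exact h5.trans (le_add_of_nonneg_left (by positivity))
  have h := hs.tendsto_integral_holeObstacle_mul hψ (fun j => by
      have h1 : ψ =ᶠ[𝓝 (a j)] fun x => Real.log ‖x - z₀‖ := by
        filter_upwards [isOpen_ball.mem_nhds (hin _ (hs.mem j).1)] with x hx using hψ1 x hx
      refine ContinuousAt.congr ?_ h1.symm
      exact ContinuousAt.log (by fun_prop) (norm_ne_zero_iff.2 (sub_ne_zero.2 (hz₀ j).symm))) hprod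
  have h0 := tendsto_integral_logExcess_mul hcont hH.aestronglyMeasurable
  have hcongr : (fun R : ℝ => 8 / (Real.pi * R ^ 4) *
      ∫ w, logExcess R (w - z₀) * holeObstacle K u a b w) =ᶠ[𝓝[>] 0]
      fun R : ℝ => ∫ x, holeObstacle K u a b x *
      (8 / (Real.pi * R ^ 4) * (∫ z in closedBall x R, ψ z) - 8 / R ^ 2 * ψ x) := by
    -- For `R < 1` and `x` in a hole, the disc lies where `ψ` is the logarithm, and the difference
    -- quotient of `ψ` is exactly the normalised excess. This is an approximate identity at `z₀`, so
    -- the weak identity recovers the value at `z₀`.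
    filter_upwards [Ioo_mem_nhdsGT one_pos] with R hR
    rw [← integral_const_mul]
    congr 1
    ext x
    by_cases hx : x ∈ filled K \ K
    · have e : ∫ z in closedBall x R, ψ z =
          Real.pi * R ^ 2 * Real.log ‖x - z₀‖ + logExcess R (x - z₀) := by
        rw [setIntegral_congr_fun measurableSet_closedBall fun z hz =>
          hψ1 z (hD x hx.1 (closedBall_subset_closedBall hR.2.le hz)),
          integral_closedBall_log x z₀ hR.1]
      have hR0 := hR.1
      have hpi := Real.pi_pos
      rw [e, hψ1 x (hin x hx.1)]
      field_simp
      ring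
    · simp [holeObstacle, indicator_of_notMem hx]
  have huniq := tendsto_nhds_unique (h0.congr' hcongr) h
  have e1 : ∫ z in filled K \ K, ψ z = logPotential (filled K \ K) z₀ := by
    rw [logPotential]
    refine setIntegral_congr_fun hs.isOpen_holes.measurableSet fun z hz => ?_
    simp only [hψ1 z (hin z hz.1), norm_sub_rev]
  have e2 : ∑ j, b j * ψ (a j) = ∑ j, b j * Real.log ‖z₀ - a j‖ :=
    Finset.sum_congr rfl fun j _ => by rw [hψ1 _ (hin _ (hs.mem j).1), norm_sub_rev]
  rw [e1, e2] at huniq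
  have hpi := Real.pi_pos
  have h2 : 2 * Real.pi * holeObstacle K u a b z₀ = 2 * Real.pi *
      (2 / Real.pi * logPotential (filled K \ K) z₀ -
        2 * ∑ j, b j * Real.log ‖z₀ - a j‖) := by
    rw [huniq]
    field_simp
    ring
  exact mul_left_cancel₀ (by positivity) h2

end SolvesObstacle

end HeleShaw

end

/-! ### Positive definiteness of the logarithmic energy -/

noncomputable section

namespace HeleShaw

open Metric Filter Topology

theorem integrable_rexp_neg_mul_norm_sq {t : ℝ} (ht : 0 < t) :
    Integrable fun x : ℂ => Real.exp (-t * ‖x‖ ^ 2) := by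
  refine Integrable.of_integral_ne_zero ?_
  rw [GaussianFourier.integral_rexp_neg_mul_sq_norm ht]
  positivity

theorem integral_rexp_pos {t : ℝ} (ht : 0 < t) : 0 < ∫ x : ℂ, Real.exp (-t * ‖x‖ ^ 2) := by
  rw [GaussianFourier.integral_rexp_neg_mul_sq_norm ht]
  positivity

/-- The parallelogram law: `2|z-x|² + 2|w-x|² = |z-w|² + 4|x - (z+w)/2|²`. After integration in `x`,
the Gaussian kernel factors as an inner product of two Gaussians. -/
theorem gaussian_mul_gaussian (t : ℝ) (z w x : ℂ) :
    Real.exp (-(2 * t) * ‖z - x‖ ^ 2) * Real.exp (-(2 * t) * ‖w - x‖ ^ 2) =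
      Real.exp (-t * ‖z - w‖ ^ 2) * Real.exp (-(4 * t) * ‖x - (z + w) / 2‖ ^ 2) := by
  rw [← Real.exp_add, ← Real.exp_add]
  congr 1
  simp only [← Complex.normSq_eq_norm_sq, Complex.normSq_apply, Complex.sub_re, Complex.sub_im,
    Complex.add_re, Complex.add_im, Complex.div_ofNat_re, Complex.div_ofNat_im]
  ring

theorem integral_gaussian_mul_gaussian (t : ℝ) (z w : ℂ) :
    ∫ x, Real.exp (-(2 * t) * ‖z - x‖ ^ 2) * Real.exp (-(2 * t) * ‖w - x‖ ^ 2) =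
      Real.exp (-t * ‖z - w‖ ^ 2) * ∫ x : ℂ, Real.exp (-(4 * t) * ‖x‖ ^ 2) := by
  simp only [gaussian_mul_gaussian]
  rw [integral_const_mul,
    integral_sub_right_eq_self (fun x : ℂ => Real.exp (-(4 * t) * ‖x‖ ^ 2)) ((z + w) / 2)]

/-- The Gaussian energy of two measures is an inner product of Gaussian convolutions. -/
theorem gaussian_energy_eq (σ τ : Measure ℂ) [IsProbabilityMeasure σ] [IsProbabilityMeasure τ]
    {t : ℝ} (ht : 0 < t) :
    Integrable (fun x => (∫ z, Real.exp (-(2 * t) * ‖z - x‖ ^ 2) ∂σ) *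
      ∫ w, Real.exp (-(2 * t) * ‖w - x‖ ^ 2) ∂τ) ∧
    (∫ p, Real.exp (-t * ‖p.1 - p.2‖ ^ 2) ∂(σ.prod τ)) *
      ∫ x : ℂ, Real.exp (-(4 * t) * ‖x‖ ^ 2) =
    ∫ x, (∫ z, Real.exp (-(2 * t) * ‖z - x‖ ^ 2) ∂σ) *
      ∫ w, Real.exp (-(2 * t) * ‖w - x‖ ^ 2) ∂τ := by
  set F : ℂ × ℂ → ℂ → ℝ := fun p x =>
    Real.exp (-(2 * t) * ‖p.1 - x‖ ^ 2) * Real.exp (-(2 * t) * ‖p.2 - x‖ ^ 2) with hF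
  have hmeas : Continuous (Function.uncurry F) := by
    rw [hF]
    simp only [Function.uncurry_def]
    fun_prop
  have hint : Integrable (Function.uncurry F) ((σ.prod τ).prod volume) := by
    refine (integrable_prod_iff hmeas.aestronglyMeasurable).2 ⟨?_, ?_⟩
    · refine Eventually.of_forall fun p => ?_
      simp only [Function.uncurry_apply_pair, hF, gaussian_mul_gaussian]
      exact ((integrable_rexp_neg_mul_norm_sq (by positivity : 0 < 4 * t)).comp_sub_right
        ((p.1 + p.2) / 2)).const_mul _
    · have e : (fun p : ℂ × ℂ => ∫ x, ‖Function.uncurry F (p, x)‖) = fun p =>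
          Real.exp (-t * ‖p.1 - p.2‖ ^ 2) * ∫ x : ℂ, Real.exp (-(4 * t) * ‖x‖ ^ 2) := by
        ext p
        rw [← integral_gaussian_mul_gaussian]
        congr 1
        ext x
        exact Real.norm_of_nonneg (mul_nonneg (Real.exp_pos _).le (Real.exp_pos _).le)
      rw [e]
      refine Integrable.mul_const ?_ _
      refine Integrable.of_bound (Continuous.aestronglyMeasurable (by fun_prop)) 1
        (Eventually.of_forall fun p => ?_)
      rw [Real.norm_of_nonneg (Real.exp_pos _).le, Real.exp_le_one_iff]
      have : 0 ≤ t * ‖p.1 - p.2‖ ^ 2 := by positivity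
      linarith
  have hinner : ∀ x, ∫ p, F p x ∂(σ.prod τ) = (∫ z, Real.exp (-(2 * t) * ‖z - x‖ ^ 2) ∂σ) *
      ∫ w, Real.exp (-(2 * t) * ‖w - x‖ ^ 2) ∂τ := fun x =>
    integral_prod_mul (fun z => Real.exp (-(2 * t) * ‖z - x‖ ^ 2))
      (fun w => Real.exp (-(2 * t) * ‖w - x‖ ^ 2))
  constructor
  · refine hint.integral_prod_right.congr (Eventually.of_forall fun x => ?_)
    exact hinner x
  · rw [← integral_mul_const]
    simp only [← integral_gaussian_mul_gaussian, ← hinner]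
    exact integral_integral_swap hint

/-- The Gaussian kernel is positive definite. -/
theorem gaussian_energy_nonneg (ν μ : Measure ℂ) [IsProbabilityMeasure ν]
    [IsProbabilityMeasure μ] {t : ℝ} (ht : 0 < t) :
    0 ≤ (∫ p, Real.exp (-t * ‖p.1 - p.2‖ ^ 2) ∂(ν.prod ν)) +
      (∫ p, Real.exp (-t * ‖p.1 - p.2‖ ^ 2) ∂(μ.prod μ)) -
      2 * ∫ p, Real.exp (-t * ‖p.1 - p.2‖ ^ 2) ∂(ν.prod μ) := by
  obtain ⟨i1, e1⟩ := gaussian_energy_eq ν ν ht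
  obtain ⟨i2, e2⟩ := gaussian_energy_eq μ μ ht
  obtain ⟨i3, e3⟩ := gaussian_energy_eq ν μ ht
  have hC := integral_rexp_pos (by positivity : 0 < 4 * t)
  have i12 : Integrable fun x => (∫ z, Real.exp (-(2 * t) * ‖z - x‖ ^ 2) ∂ν) *
      (∫ w, Real.exp (-(2 * t) * ‖w - x‖ ^ 2) ∂ν) +
      (∫ z, Real.exp (-(2 * t) * ‖z - x‖ ^ 2) ∂μ) *
      ∫ w, Real.exp (-(2 * t) * ‖w - x‖ ^ 2) ∂μ := i1.add i2
  refine nonneg_of_mul_nonneg_left ?_ hC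
  rw [sub_mul, add_mul, mul_assoc 2, e1, e2, e3, ← integral_const_mul, ← integral_add i1 i2,
    ← integral_sub i12 (i3.const_mul 2)]
  refine integral_nonneg fun x => ?_
  simp only [Pi.zero_apply]
  nlinarith [sq_nonneg ((∫ z, Real.exp (-(2 * t) * ‖z - x‖ ^ 2) ∂ν) -
    ∫ z, Real.exp (-(2 * t) * ‖z - x‖ ^ 2) ∂μ)]

/-- A truncation of Frullani's integral for `-log a`. -/
def truncLog (n : ℕ) (a : ℝ) : ℝ :=
  ∫ t in ((n : ℝ) + 1)⁻¹..((n : ℝ) + 1), t⁻¹ * (Real.exp (-t * a) - Real.exp (-t))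

theorem tendsto_truncLog {a : ℝ} (ha : 0 < a) :
    Tendsto (fun n => truncLog n a) atTop (𝓝 (-Real.log a)) := by
  have h := Frullani.tendsto_intervalIntegral (f := fun x : ℝ => Real.exp (-x)) (L := 1) (R := 0)
    (a := a) (b := 1) ((by fun_prop : Continuous fun x : ℝ => Real.exp (-x)).locallyIntegrable
      |>.locallyIntegrableOn _) ha one_pos
    (by
      have : Continuous fun x : ℝ => Real.exp (-x) := by fun_prop
      simpa using (this.tendsto 0).mono_left nhdsWithin_le_nhds)
    (Real.tendsto_exp_neg_atTop_nhds_zero)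
  have h1 : Tendsto (fun n : ℕ => ((n : ℝ) + 1)) atTop atTop :=
    tendsto_atTop_add_const_right _ _ tendsto_natCast_atTop_atTop
  have h2 : Tendsto (fun n : ℕ => ((n : ℝ) + 1)⁻¹) atTop (𝓝[>] 0) :=
    tendsto_inv_atTop_nhdsGT_zero.comp h1
  have h3 := h.comp (h2.prodMk h1)
  simp only [one_div, Real.log_inv, sub_zero, smul_eq_mul, mul_one, Function.comp_def] at h3
  refine h3.congr fun n => ?_
  simp only [truncLog]
  congr 1
  ext t
  rw [one_mul, neg_mul, mul_comm a t]

theorem truncLog_intervalIntegrable (a : ℝ) {x y : ℝ} (hx : 0 < x) (hy : 0 < y) :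
    IntervalIntegrable (fun t => t⁻¹ * (Real.exp (-t * a) - Real.exp (-t))) volume x y := by
  refine ContinuousOn.intervalIntegrable ?_
  refine ContinuousOn.mul (ContinuousOn.inv₀ continuousOn_id fun t ht => ?_) (by fun_prop)
  have : 0 < t := lt_of_lt_of_le (lt_min hx hy) ht.1
  exact this.ne'

/-- The factor `s`, taken as `1` for `a ≤ 1` and `-1` for `a ≥ 1`, makes the integrand nonnegative,
so enlarging the interval increases the integral. -/
theorem truncLog_mono_abs (a : ℝ) {n k : ℕ} (hnk : n ≤ k) (s : ℝ)
    (hs : ∀ t : ℝ, 0 < t → 0 ≤ s * (Real.exp (-t * a) - Real.exp (-t))) :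
    s * truncLog n a ≤ s * truncLog k a := by
  have h : (n : ℝ) ≤ k := by exact_mod_cast hnk
  have hn : (0 : ℝ) < (n : ℝ) + 1 := by positivity
  have hk : (0 : ℝ) < (k : ℝ) + 1 := by positivity
  have h1 : ((n : ℝ) + 1)⁻¹ ≤ (n : ℝ) + 1 := by
    rw [inv_le_iff_one_le_mul₀ hn]
    nlinarith
  rw [truncLog, truncLog, ← intervalIntegral.integral_const_mul,
    ← intervalIntegral.integral_const_mul]
  refine intervalIntegral.integral_mono_interval (by gcongr) h1 (by linarith) ?_
    ((truncLog_intervalIntegrable a (by positivity) hk).const_mul s)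
  filter_upwards [ae_restrict_mem measurableSet_Ioc] with t ht
  have ht0 : 0 < t := lt_trans (by positivity) ht.1
  have : s * (t⁻¹ * (Real.exp (-t * a) - Real.exp (-t))) =
      t⁻¹ * (s * (Real.exp (-t * a) - Real.exp (-t))) := by ring
  rw [Pi.zero_apply, this]
  exact mul_nonneg (by positivity) (hs t ht0)

theorem truncLog_sign (a : ℝ) (n : ℕ) (s : ℝ)
    (hs : ∀ t : ℝ, 0 < t → 0 ≤ s * (Real.exp (-t * a) - Real.exp (-t))) :
    0 ≤ s * truncLog n a := by
  have h : s * truncLog 0 a ≤ s * truncLog n a := truncLog_mono_abs a (Nat.zero_le n) s hs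
  -- For `n = 0` the interval of integration is degenerate, from `1` to `1`.
  simpa [truncLog] using h

/-- The truncations have constant sign and grow in absolute value towards `|log a|`; this supplies
the dominating function when the truncation is removed. -/
theorem abs_truncLog_le {a : ℝ} (ha : 0 < a) (n : ℕ) : |truncLog n a| ≤ |Real.log a| := by
  have key : ∀ s : ℝ, (∀ t : ℝ, 0 < t → 0 ≤ s * (Real.exp (-t * a) - Real.exp (-t))) →
      0 ≤ s * truncLog n a ∧ s * truncLog n a ≤ s * -Real.log a := fun s hs =>
    ⟨truncLog_sign a n s hs, Monotone.ge_of_tendsto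
      (f := fun n => s * truncLog n a) (fun _ _ h => truncLog_mono_abs a h s hs)
      ((tendsto_truncLog ha).const_mul s) n⟩
  rcases le_total a 1 with h | h
  · obtain ⟨h1, h2⟩ := key 1 fun t ht => by
      rw [one_mul, sub_nonneg, Real.exp_le_exp]
      nlinarith
    rw [one_mul] at h1
    rw [abs_of_nonneg h1]
    linarith [neg_le_abs (Real.log a)]
  · obtain ⟨h1, h2⟩ := key (-1) fun t ht => by
      have : Real.exp (-t * a) ≤ Real.exp (-t) := by
        rw [Real.exp_le_exp]
        nlinarith
      linarith
    rw [abs_of_nonpos (by linarith)]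
    linarith [le_abs_self (Real.log a)]

/-- Fubini for the truncated logarithmic energy. -/
theorem integral_truncLog (σ τ : Measure ℂ) [IsProbabilityMeasure σ] [IsProbabilityMeasure τ]
    (n : ℕ) :
    IntervalIntegrable (fun t : ℝ => t⁻¹ *
      ((∫ p, Real.exp (-t * ‖p.1 - p.2‖ ^ 2) ∂(σ.prod τ)) - Real.exp (-t))) volume
      ((n : ℝ) + 1)⁻¹ ((n : ℝ) + 1) ∧
    ∫ p, truncLog n (‖p.1 - p.2‖ ^ 2) ∂(σ.prod τ) =
      ∫ t in ((n : ℝ) + 1)⁻¹..((n : ℝ) + 1), t⁻¹ *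
        ((∫ p, Real.exp (-t * ‖p.1 - p.2‖ ^ 2) ∂(σ.prod τ)) - Real.exp (-t)) := by
  have hn : (0 : ℝ) < (n : ℝ) + 1 := by positivity
  have hle : ((n : ℝ) + 1)⁻¹ ≤ (n : ℝ) + 1 := by
    rw [inv_le_iff_one_le_mul₀ hn]
    nlinarith [(by positivity : (0 : ℝ) ≤ n)]
  set F : ℂ × ℂ → ℝ → ℝ := fun p t => t⁻¹ * (Real.exp (-t * ‖p.1 - p.2‖ ^ 2) - Real.exp (-t))
    with hF
  have hexp : ∀ t : ℝ, 0 < t → Integrable (fun p : ℂ × ℂ => Real.exp (-t * ‖p.1 - p.2‖ ^ 2))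
      (σ.prod τ) := fun t ht => by
    refine Integrable.of_bound (Continuous.aestronglyMeasurable (by fun_prop)) 1
      (Eventually.of_forall fun p => ?_)
    rw [Real.norm_of_nonneg (Real.exp_pos _).le, Real.exp_le_one_iff]
    have : 0 ≤ t * ‖p.1 - p.2‖ ^ 2 := by positivity
    linarith
  have hint : Integrable (Function.uncurry F)
      ((σ.prod τ).prod (volume.restrict (Ioc ((n : ℝ) + 1)⁻¹ ((n : ℝ) + 1)))) := by
    refine Integrable.of_bound (Measurable.aestronglyMeasurable ?_) (((n : ℝ) + 1) * 1) ?_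
    · rw [hF]
      simp only [Function.uncurry_def]
      fun_prop
    · have hmem : ∀ᵐ q : (ℂ × ℂ) × ℝ ∂((σ.prod τ).prod
          (volume.restrict (Ioc ((n : ℝ) + 1)⁻¹ ((n : ℝ) + 1)))),
          q.2 ∈ Ioc ((n : ℝ) + 1)⁻¹ ((n : ℝ) + 1) :=
        Measure.quasiMeasurePreserving_snd.ae (ae_restrict_mem measurableSet_Ioc)
      filter_upwards [hmem] with ⟨p, t⟩ ht
      have hpos : (0 : ℝ) < ((n : ℝ) + 1)⁻¹ := by positivity
      have ht0 : 0 < t := hpos.trans ht.1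
      simp only [Function.uncurry_apply_pair, hF]
      rw [norm_mul, Real.norm_of_nonneg (by positivity : 0 ≤ t⁻¹)]
      have h1 : t⁻¹ ≤ (n : ℝ) + 1 := by
        rw [inv_le_comm₀ ht0 hn]
        exact ht.1.le
      have h2 : Real.exp (-t * ‖p.1 - p.2‖ ^ 2) ≤ 1 := by
        rw [Real.exp_le_one_iff]
        have : 0 ≤ t * ‖p.1 - p.2‖ ^ 2 := by positivity
        linarith
      have h3 : Real.exp (-t) ≤ 1 := by
        rw [Real.exp_le_one_iff]
        linarith
      have h4 : ‖Real.exp (-t * ‖p.1 - p.2‖ ^ 2) - Real.exp (-t)‖ ≤ 1 := by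
        rw [Real.norm_eq_abs, abs_le]
        constructor <;> linarith [Real.exp_pos (-t), Real.exp_pos (-t * ‖p.1 - p.2‖ ^ 2)]
      gcongr
  have hinner : ∀ t : ℝ, 0 < t → ∫ p, F p t ∂(σ.prod τ) = t⁻¹ *
      ((∫ p, Real.exp (-t * ‖p.1 - p.2‖ ^ 2) ∂(σ.prod τ)) - Real.exp (-t)) := fun t ht => by
    rw [hF]
    simp only
    rw [integral_const_mul, integral_sub (hexp t ht) (integrable_const _)]
    simp
  have hae : ∀ᵐ t ∂(volume.restrict (Ioc ((n : ℝ) + 1)⁻¹ ((n : ℝ) + 1))),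
      ∫ p, F p t ∂(σ.prod τ) = t⁻¹ *
      ((∫ p, Real.exp (-t * ‖p.1 - p.2‖ ^ 2) ∂(σ.prod τ)) - Real.exp (-t)) := by
    filter_upwards [ae_restrict_mem measurableSet_Ioc] with t ht
    exact hinner t (lt_trans (by positivity) ht.1)
  constructor
  · rw [intervalIntegrable_iff_integrableOn_Ioc_of_le hle]
    exact hint.integral_prod_right.congr hae
  · simp only [truncLog, intervalIntegral.integral_of_le hle]
    rw [← integral_congr_ae hae]
    exact integral_integral_swap hint

/-- In the combination `1 + 1 - 2` the terms `exp (-t)` cancel, since both measures have mass one.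
What remains is an integral of Gaussian energies against the positive weight `1 / t`. -/
theorem truncLog_energy_nonneg (ν μ : Measure ℂ) [IsProbabilityMeasure ν]
    [IsProbabilityMeasure μ] (n : ℕ) :
    0 ≤ (∫ p, truncLog n (‖p.1 - p.2‖ ^ 2) ∂(ν.prod ν)) +
      (∫ p, truncLog n (‖p.1 - p.2‖ ^ 2) ∂(μ.prod μ)) -
      2 * ∫ p, truncLog n (‖p.1 - p.2‖ ^ 2) ∂(ν.prod μ) := by
  obtain ⟨i1, e1⟩ := integral_truncLog ν ν n
  obtain ⟨i2, e2⟩ := integral_truncLog μ μ n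
  obtain ⟨i3, e3⟩ := integral_truncLog ν μ n
  have hn : (0 : ℝ) < (n : ℝ) + 1 := by positivity
  have hle : ((n : ℝ) + 1)⁻¹ ≤ (n : ℝ) + 1 := by
    rw [inv_le_iff_one_le_mul₀ hn]
    nlinarith [(by positivity : (0 : ℝ) ≤ n)]
  rw [e1, e2, e3, ← intervalIntegral.integral_const_mul, ← intervalIntegral.integral_add i1 i2,
    ← intervalIntegral.integral_sub (i1.add i2) (i3.const_mul 2)]
  refine intervalIntegral.integral_nonneg hle fun t ht => ?_
  have ht0 : 0 < t := lt_of_lt_of_le (by positivity) ht.1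
  have h := mul_nonneg (inv_pos.2 ht0).le (gaussian_energy_nonneg ν μ ht0)
  linarith

theorem ae_prod_ne (σ τ : Measure ℂ) [SFinite σ] [SFinite τ] (h : ∀ z, τ {z} = 0) :
    ∀ᵐ p : ℂ × ℂ ∂(σ.prod τ), p.1 ≠ p.2 := by
  rw [ae_iff]
  have hm : MeasurableSet {p : ℂ × ℂ | ¬ p.1 ≠ p.2} := by
    simp only [not_not]
    exact measurableSet_eq_fun measurable_fst measurable_snd
  rw [Measure.measure_prod_null hm]
  refine Eventually.of_forall fun z => ?_
  have : Prod.mk z ⁻¹' {p : ℂ × ℂ | ¬ p.1 ≠ p.2} = {z} := by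
    ext w
    simp [eq_comm]
  simp only [this, h z, Pi.zero_apply]

theorem measurable_truncLog (n : ℕ) : StronglyMeasurable (truncLog n) := by
  have hle : ((n : ℝ) + 1)⁻¹ ≤ (n : ℝ) + 1 := by
    have hn : (0 : ℝ) < (n : ℝ) + 1 := by positivity
    rw [inv_le_iff_one_le_mul₀ hn]
    nlinarith [(by positivity : (0 : ℝ) ≤ n)]
  have e : truncLog n = fun a => ∫ t in Ioc ((n : ℝ) + 1)⁻¹ ((n : ℝ) + 1),
      t⁻¹ * (Real.exp (-t * a) - Real.exp (-t)) := by
    ext a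
    rw [truncLog, intervalIntegral.integral_of_le hle]
  rw [e]
  refine StronglyMeasurable.integral_prod_right (Measurable.stronglyMeasurable ?_)
  simp only [Function.uncurry_def]
  fun_prop

theorem tendsto_integral_truncLog (σ τ : Measure ℂ) [IsProbabilityMeasure σ]
    [IsProbabilityMeasure τ] (h : ∀ z, τ {z} = 0)
    (hi : Integrable (fun p : ℂ × ℂ => Real.log (1 / ‖p.1 - p.2‖)) (σ.prod τ)) :
    Tendsto (fun n => ∫ p, truncLog n (‖p.1 - p.2‖ ^ 2) ∂(σ.prod τ)) atTop
      (𝓝 (2 * ∫ p, Real.log (1 / ‖p.1 - p.2‖) ∂(σ.prod τ))) := by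
  rw [← integral_const_mul]
  have hlog : ∀ p : ℂ × ℂ, Real.log (‖p.1 - p.2‖ ^ 2) = -(2 * Real.log (1 / ‖p.1 - p.2‖)) := by
    intro p
    rw [one_div, Real.log_inv, Real.log_pow]
    push_cast
    ring
  refine tendsto_integral_of_dominated_convergence
    (fun p => ‖2 * Real.log (1 / ‖p.1 - p.2‖)‖) (fun n => ?_) (hi.const_mul 2).norm
    (fun n => ?_) ?_
  · exact ((measurable_truncLog n).measurable.comp
      (by fun_prop : Measurable fun p : ℂ × ℂ => ‖p.1 - p.2‖ ^ 2)).aestronglyMeasurable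
  · filter_upwards [ae_prod_ne σ τ h] with p hp
    have hpos : 0 < ‖p.1 - p.2‖ := norm_pos_iff.2 (sub_ne_zero.2 hp)
    have := abs_truncLog_le (by positivity : 0 < ‖p.1 - p.2‖ ^ 2) n
    rwa [hlog, abs_neg] at this
  · filter_upwards [ae_prod_ne σ τ h] with p hp
    have hpos : 0 < ‖p.1 - p.2‖ := norm_pos_iff.2 (sub_ne_zero.2 hp)
    have := tendsto_truncLog (by positivity : 0 < ‖p.1 - p.2‖ ^ 2)
    rwa [hlog, neg_neg] at this

/-- The logarithmic energy of the difference of two probability measures is nonnegative. -/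
theorem log_energy_nonneg (ν μ : Measure ℂ) [IsProbabilityMeasure ν] [IsProbabilityMeasure μ]
    (hν : ∀ z, ν {z} = 0) (hμ : ∀ z, μ {z} = 0)
    (hνν : Integrable (fun p : ℂ × ℂ => Real.log (1 / ‖p.1 - p.2‖)) (ν.prod ν))
    (hμμ : Integrable (fun p : ℂ × ℂ => Real.log (1 / ‖p.1 - p.2‖)) (μ.prod μ))
    (hνμ : Integrable (fun p : ℂ × ℂ => Real.log (1 / ‖p.1 - p.2‖)) (ν.prod μ)) :
    0 ≤ (∫ p, Real.log (1 / ‖p.1 - p.2‖) ∂(ν.prod ν)) +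
      (∫ p, Real.log (1 / ‖p.1 - p.2‖) ∂(μ.prod μ)) -
      2 * ∫ p, Real.log (1 / ‖p.1 - p.2‖) ∂(ν.prod μ) := by
  have h := ((tendsto_integral_truncLog ν ν hν hνν).add
    (tendsto_integral_truncLog μ μ hμ hμμ)).sub
    ((tendsto_integral_truncLog ν μ hμ hνμ).const_mul 2)
  have h0 := ge_of_tendsto' h fun n => truncLog_energy_nonneg ν μ n
  linarith

end HeleShaw

end

/-! ### Variational conditions: Euler-Lagrange inequality and sufficiency -/

noncomputable section

namespace HeleShaw

open Metric Filter Topology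

theorem log_one_div_eq (x : ℂ) : Real.log (1 / ‖x‖) = -Real.log ‖x‖ := by
  rw [one_div, Real.log_inv]

theorem integrable_log_one_div_prod {A B : Set ℂ} (hA : IsCompact A) (hB : IsCompact B) :
    Integrable (fun p : ℂ × ℂ => Real.log (1 / ‖p.1 - p.2‖))
      ((volume.restrict A).prod (volume.restrict B)) := by
  simp only [log_one_div_eq]
  exact (integrable_log_norm_prod hA.isBounded hB.isBounded hA.measurableSet hB.measurableSet).neg

theorem integral_log_one_div_prod {A B : Set ℂ} (hA : IsCompact A) (hB : IsCompact B) :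
    ∫ p : ℂ × ℂ, Real.log (1 / ‖p.1 - p.2‖) ∂((volume.restrict A).prod (volume.restrict B)) =
      -∫ z in A, logPotential B z := by
  rw [integral_prod _ (integrable_log_one_div_prod hA hB)]
  simp only [log_one_div_eq, integral_neg]
  rfl

theorem prod_combination (A B : Set ℂ) {p q : ℝ} (hp : 0 ≤ p) (hq : 0 ≤ q) :
    (ENNReal.ofReal p • volume.restrict A + ENNReal.ofReal q • volume.restrict B).prod
      (ENNReal.ofReal p • volume.restrict A + ENNReal.ofReal q • volume.restrict B) =
    ENNReal.ofReal (p * p) • (volume.restrict A).prod (volume.restrict A) +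
    ENNReal.ofReal (q * p) • (volume.restrict B).prod (volume.restrict A) +
    (ENNReal.ofReal (p * q) • (volume.restrict A).prod (volume.restrict B) +
    ENNReal.ofReal (q * q) • (volume.restrict B).prod (volume.restrict B)) := by
  rw [Measure.prod_add, Measure.add_prod, Measure.add_prod]
  simp only [Measure.prod_smul_left, Measure.prod_smul_right, smul_smul, ENNReal.ofReal_mul hp,
    ENNReal.ofReal_mul hq]
  simp only [mul_comm]

/-- Energies of combinations of area measures on compact sets. -/
theorem energy_combination {Q : ℂ → ℝ} {A B : Set ℂ} (hA : IsCompact A) (hB : IsCompact B)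
    (hQA : IntegrableOn Q A) (hQB : IntegrableOn Q B) {p q : ℝ} (hp : 0 ≤ p) (hq : 0 ≤ q) :
    FiniteEnergy Q (ENNReal.ofReal p • volume.restrict A + ENNReal.ofReal q • volume.restrict B) ∧
    energy Q (ENNReal.ofReal p • volume.restrict A + ENNReal.ofReal q • volume.restrict B) =
      -(p * p * ∫ z in A, logPotential A z) - 2 * (p * q * ∫ z in B, logPotential A z) -
        q * q * (∫ z in B, logPotential B z) + p * (∫ z in A, Q z) + q * ∫ z in B, Q z := by
  have iAA := (integrable_log_one_div_prod hA hA).smul_measure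
    (ENNReal.ofReal_ne_top (r := p * p))
  have iBA := (integrable_log_one_div_prod hB hA).smul_measure
    (ENNReal.ofReal_ne_top (r := q * p))
  have iAB := (integrable_log_one_div_prod hA hB).smul_measure
    (ENNReal.ofReal_ne_top (r := p * q))
  have iBB := (integrable_log_one_div_prod hB hB).smul_measure
    (ENNReal.ofReal_ne_top (r := q * q))
  have iA := Integrable.smul_measure hQA (ENNReal.ofReal_ne_top (r := p))
  have iB := Integrable.smul_measure hQB (ENNReal.ofReal_ne_top (r := q))
  constructor
  · refine ⟨fun z => ?_, ?_, iA.add_measure iB⟩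
    · simp
    · rw [prod_combination A B hp hq]
      exact (iAA.add_measure iBA).add_measure (iAB.add_measure iBB)
  · rw [energy, prod_combination A B hp hq,
      integral_add_measure (iAA.add_measure iBA) (iAB.add_measure iBB),
      integral_add_measure iAA iBA, integral_add_measure iAB iBB, integral_add_measure iA iB]
    simp only [integral_smul_measure, integral_log_one_div_prod hA hA,
      integral_log_one_div_prod hB hA, integral_log_one_div_prod hA hB,
      integral_log_one_div_prod hB hB, smul_eq_mul, ENNReal.toReal_ofReal hp,
      ENNReal.toReal_ofReal hq, ENNReal.toReal_ofReal (mul_nonneg hp hp),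
      ENNReal.toReal_ofReal (mul_nonneg hq hp), ENNReal.toReal_ofReal (mul_nonneg hp hq),
      ENNReal.toReal_ofReal (mul_nonneg hq hq), setIntegral_logPotential_comm hA hB]
    ring

theorem energy_smul_restrict {Q : ℂ → ℝ} {A : Set ℂ} (hA : IsCompact A)
    (hQA : IntegrableOn Q A) {p : ℝ} (hp : 0 ≤ p) :
    FiniteEnergy Q (ENNReal.ofReal p • volume.restrict A) ∧
    energy Q (ENNReal.ofReal p • volume.restrict A) =
      -(p * p * ∫ z in A, logPotential A z) + p * ∫ z in A, Q z := by
  have h := energy_combination hA isCompact_empty hQA integrableOn_empty hp (le_refl (0 : ℝ))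
  simpa using h

theorem isProbabilityMeasure_combination {A B : Set ℂ} (hA : IsCompact A) (hB : IsCompact B)
    {p q : ℝ} (hp : 0 ≤ p) (hq : 0 ≤ q) (h : p * volume.real A + q * volume.real B = 1) :
    IsProbabilityMeasure
      (ENNReal.ofReal p • volume.restrict A + ENNReal.ofReal q • volume.restrict B) := by
  constructor
  simp only [Measure.add_apply, Measure.smul_apply, Measure.restrict_apply_univ, smul_eq_mul]
  rw [← ofReal_measureReal hA.measure_lt_top.ne, ← ofReal_measureReal hB.measure_lt_top.ne,
    ← ENNReal.ofReal_mul hp, ← ENNReal.ofReal_mul hq, ← ENNReal.ofReal_add (by positivity)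
    (by positivity), h, ENNReal.ofReal_one]

theorem nonneg_of_forall_quadratic {A B : ℝ} (h : ∀ s : ℝ, 0 < s → s ≤ 1 → 0 ≤ s * A + s ^ 2 * B) :
    0 ≤ A := by
  have h1 : Tendsto (fun s : ℝ => A + s * B) (𝓝[>] 0) (𝓝 A) := by
    have : Continuous fun s : ℝ => A + s * B := by fun_prop
    simpa using (this.tendsto 0).mono_left nhdsWithin_le_nhds
  refine ge_of_tendsto h1 ?_
  filter_upwards [Ioc_mem_nhdsGT one_pos] with s hs
  have h2 := h s hs.1 hs.2
  have h3 : 0 ≤ s * (A + s * B) := by linarith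
  exact nonneg_of_mul_nonneg_right h3 hs.1

/-- The Euler-Lagrange inequality, integrated over a compact set. -/
theorem euler_lagrange_integrated {Q : ℂ → ℝ} {S K B : Set ℂ} {β : ℝ} (hβ : 0 ≤ β)
    (hK : IsCompact K) (hKS : K ⊆ S) (hQK : IntegrableOn Q K) (hprob : β * volume.real K = 1)
    (hmin : ∀ ν : Measure ℂ, IsProbabilityMeasure ν → ν Sᶜ = 0 → FiniteEnergy Q ν →
      energy Q (ENNReal.ofReal β • volume.restrict K) ≤ energy Q ν)
    (hB : IsCompact B) (hBS : B ⊆ S) (hQB : IntegrableOn Q B) {η : ℝ} (hη : 0 ≤ η)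
    (hηB : η * volume.real B = 1) :
    β * (∫ w in K, (Q w - 2 * β * logPotential K w)) ≤
      η * ∫ w in B, (Q w - 2 * β * logPotential K w) := by
  have hlog : ∀ C, IsCompact C → IntegrableOn (logPotential K) C := fun C hC =>
    (continuous_logPotential hK).continuousOn.integrableOn_compact hC
  rw [integral_sub hQK ((hlog K hK).const_mul _), integral_sub hQB ((hlog B hB).const_mul _),
    integral_const_mul, integral_const_mul]
  have e0 := (energy_smul_restrict hK hQK hβ).2
  rw [← sub_nonneg]
  -- The competitor is `(1 - s) μ + s σ`, with `μ` the minimiser and `σ` normalised area on `B`. The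
  -- energy increment is quadratic in `s`; its linear coefficient is the difference of the two sides
  -- of the claim, and the constant `B` given here is the coefficient of `s²`.
  refine nonneg_of_forall_quadratic (B := -(β * β * ∫ z in K, logPotential K z) +
    2 * (β * η * ∫ z in B, logPotential K z) - η * η * ∫ z in B, logPotential B z)
    fun s hs hs1 => ?_
  have hp : 0 ≤ (1 - s) * β := mul_nonneg (by linarith) hβ
  have hq : 0 ≤ s * η := mul_nonneg hs.le hη
  obtain ⟨hfin, hen⟩ := energy_combination hK hB hQK hQB hp hq
  have hpr := isProbabilityMeasure_combination hK hB hp hq (by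
    rw [mul_assoc, mul_assoc, hprob, hηB]
    ring)
  have hnull : ∀ C, C ⊆ S → IsCompact C → volume.restrict C Sᶜ = 0 := fun C hC hCc => by
    rw [Measure.restrict_apply' hCc.measurableSet,
      (disjoint_compl_left_iff_subset.2 hC).inter_eq, measure_empty]
  have h := hmin _ hpr (by
    simp [hnull K hKS hK, hnull B hBS hB]) hfin
  rw [e0, hen] at h
  linarith

/-- The Euler-Lagrange inequality for an energy-minimizing area measure. -/
theorem euler_lagrange {Q : ℂ → ℝ} {S K : Set ℂ} {β : ℝ} (hβ : 0 ≤ β)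
    (hK : IsCompact K) (hKS : K ⊆ S) (hQK : IntegrableOn Q K) (hprob : β * volume.real K = 1)
    (hmin : ∀ ν : Measure ℂ, IsProbabilityMeasure ν → ν Sᶜ = 0 → FiniteEnergy Q ν →
      energy Q (ENNReal.ofReal β • volume.restrict K) ≤ energy Q ν)
    {z : ℂ} (hz : S ∈ 𝓝 z) (hQz : ∀ᶠ x in 𝓝 z, ContinuousAt Q x) :
    β * (∫ w in K, (Q w - 2 * β * logPotential K w)) ≤ Q z - 2 * β * logPotential K z := by
  set γ := β * (∫ w in K, (Q w - 2 * β * logPotential K w))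
  -- If the inequality failed at `z`, it would fail by continuity with a margin on a small disc
  -- about `z`, contradicting the integrated inequality for normalised area on that disc.
  by_contra! hlt
  have hcont : ContinuousAt (fun x => Q x - 2 * β * logPotential K x) z :=
    hQz.self_of_nhds.sub ((continuous_logPotential hK).continuousAt.const_mul _)
  obtain ⟨c, hc1, hc2⟩ := exists_between hlt
  obtain ⟨r, hr, hrS⟩ := Metric.nhds_basis_closedBall.mem_iff.1
    (inter_mem (inter_mem hz hQz) (hcont.eventually (gt_mem_nhds hc1)))
  set B := closedBall z r
  have hB : IsCompact B := isCompact_closedBall z r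
  have hQB : ContinuousOn Q B := fun x hx => (hrS hx).1.2.continuousWithinAt
  have hvol : volume.real B = Real.pi * r ^ 2 := volume_real_closedBall z hr.le
  have hpi := Real.pi_pos
  have h := euler_lagrange_integrated hβ hK hKS hQK hprob hmin hB (fun x hx => (hrS hx).1.1)
    (hQB.integrableOn_compact hB) (by positivity : 0 ≤ (volume.real B)⁻¹)
    (inv_mul_cancel₀ (by rw [hvol]; positivity))
  have hint : IntegrableOn (fun x => Q x - 2 * β * logPotential K x) B :=
    (hQB.sub ((continuous_logPotential hK).continuousOn.const_mul _)).integrableOn_compact hB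
  have h2 : ∫ w in B, (Q w - 2 * β * logPotential K w) ≤ ∫ _ in B, c :=
    setIntegral_mono_on hint (integrableOn_const hB.measure_lt_top.ne) hB.measurableSet
      fun x hx => (hrS hx).2.le
  rw [setIntegral_const, smul_eq_mul] at h2
  have hv : 0 < volume.real B := by rw [hvol]; positivity
  have h3 : (volume.real B)⁻¹ * (∫ w in B, (Q w - 2 * β * logPotential K w)) ≤ c := by
    rw [inv_mul_le_iff₀ hv]
    exact h2
  linarith

/-- The inner integral of `|log|` over `K` is bounded uniformly for `z` in `S` by its integral over
one disc containing all differences, so any finite measure carried by `S` is admissible. -/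
theorem integrable_log_one_div_prod_restrict {ν : Measure ℂ} [IsFiniteMeasure ν] {S K : Set ℂ}
    (hS : IsCompact S) (hK : IsCompact K) (hν : ν Sᶜ = 0) :
    Integrable (fun p : ℂ × ℂ => Real.log (1 / ‖p.1 - p.2‖)) (ν.prod (volume.restrict K)) := by
  simp only [log_one_div_eq]
  refine Integrable.neg ?_
  have hm : Measurable fun p : ℂ × ℂ => Real.log ‖p.1 - p.2‖ := by fun_prop
  refine (integrable_prod_iff hm.aestronglyMeasurable).2 ⟨Eventually.of_forall fun z =>
    integrableOn_log_norm_sub' z hK.isBounded, ?_⟩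
  obtain ⟨D, hD⟩ := (hS.isBounded.sub hK.isBounded).subset_closedBall 0
  have hI := (integrableOn_closedBall_log_norm D).norm
  refine Integrable.of_bound (hm.norm.stronglyMeasurable.integral_prod_right').aestronglyMeasurable
    (∫ x in closedBall (0 : ℂ) D, ‖Real.log ‖x‖‖) ?_
  have hae : ∀ᵐ z ∂ν, z ∈ S := hν
  filter_upwards [hae] with z hz
  rw [Real.norm_of_nonneg (integral_nonneg fun w => norm_nonneg _)]
  have hind : Integrable ((closedBall (0 : ℂ) D).indicator fun x => ‖Real.log ‖x‖‖) :=
    (integrable_indicator_iff measurableSet_closedBall).2 hI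
  calc ∫ w in K, ‖Real.log ‖z - w‖‖
      = ∫ w in K, (closedBall (0 : ℂ) D).indicator (fun x => ‖Real.log ‖x‖‖) (z - w) :=
        setIntegral_congr_fun hK.measurableSet fun w hw =>
          (indicator_of_mem (hD (sub_mem_sub hz hw)) fun x => ‖Real.log ‖x‖‖).symm
    _ ≤ ∫ w, (closedBall (0 : ℂ) D).indicator (fun x => ‖Real.log ‖x‖‖) (z - w) :=
        setIntegral_le_integral (hind.comp_sub_left z)
          (Eventually.of_forall fun w => indicator_nonneg (fun _ _ => norm_nonneg _) _)
    _ = ∫ x in closedBall (0 : ℂ) D, ‖Real.log ‖x‖‖ := by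
        rw [integral_sub_left_eq_self
          ((closedBall (0 : ℂ) D).indicator fun x => ‖Real.log ‖x‖‖) volume z,
          integral_indicator measurableSet_closedBall]

/-- The obstacle inequalities are sufficient for minimality. -/
theorem energy_le_of_obstacle {Q : ℂ → ℝ} {S K F : Set ℂ} {β γ : ℝ} (hβ : 0 ≤ β)
    (hS : IsCompact S) (hK : IsCompact K) (hKS : K ⊆ S) (hQ : ContinuousOn Q S)
    (hprob : β * volume.real K = 1) (hF : F.Finite)
    (heq : ∀ z ∈ K, z ∉ F → Q z - 2 * β * logPotential K z = γ)
    (hge : ∀ z ∈ S, z ∉ F → γ ≤ Q z - 2 * β * logPotential K z)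
    {ν : Measure ℂ} [IsProbabilityMeasure ν] (hν : ν Sᶜ = 0) (hfin : FiniteEnergy Q ν) :
    energy Q (ENNReal.ofReal β • volume.restrict K) ≤ energy Q ν := by
  set μ := ENNReal.ofReal β • volume.restrict K with hμ
  have hQK : IntegrableOn Q K := (hQ.mono hKS).integrableOn_compact hK
  obtain ⟨hμfin, hμen⟩ := energy_smul_restrict hK hQK hβ
  have hμprob : IsProbabilityMeasure μ := by
    have := isProbabilityMeasure_combination hK isCompact_empty hβ (le_refl (0 : ℝ))
      (by rw [hprob]; simp)
    simpa using this
  have hLp := continuous_logPotential hK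
  have hνμ : Integrable (fun p : ℂ × ℂ => Real.log (1 / ‖p.1 - p.2‖)) (ν.prod μ) := by
    rw [hμ, Measure.prod_smul_right]
    exact (integrable_log_one_div_prod_restrict hS hK hν).smul_measure ENNReal.ofReal_ne_top
  have hcross : ∫ p : ℂ × ℂ, Real.log (1 / ‖p.1 - p.2‖) ∂(ν.prod μ) =
      -(β * ∫ z, logPotential K z ∂ν) := by
    rw [hμ, Measure.prod_smul_right, integral_smul_measure,
      integral_prod _ (integrable_log_one_div_prod_restrict hS hK hν)]
    simp only [log_one_div_eq, integral_neg, ENNReal.toReal_ofReal hβ, smul_eq_mul]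
    rw [mul_neg]
    rfl
  -- Positivity gives `I[ν] ≥ 2 I[ν, μ] - I[μ]` for the logarithmic energies. It then suffices to
  -- compare the integrals of `Q - 2 β logPotential K` against `ν` and `μ`: the first is at least
  -- `γ`, the second equals `γ`.
  have hpos := log_energy_nonneg ν μ hfin.no_atoms hμfin.no_atoms hfin.log_integrable
    hμfin.log_integrable hνμ
  rw [hcross] at hpos
  have hae : ∀ᵐ z ∂ν, z ∈ S := hν
  -- The finite exceptional set is invisible to both measures: `ν` has no atoms and area ignores
  -- points.
  have hFν : ∀ᵐ z ∂ν, z ∉ F := by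
    have : ν F = 0 := by
      rw [← biUnion_of_singleton F, measure_biUnion_null_iff hF.countable]
      exact fun z _ => hfin.no_atoms z
    exact measure_eq_zero_iff_ae_notMem.1 this
  have hFK : ∀ᵐ z ∂(volume.restrict K), z ∉ F :=
    ae_restrict_of_ae (measure_eq_zero_iff_ae_notMem.1 (hF.measure_zero volume))
  have hLν : Integrable (logPotential K) ν := by
    obtain ⟨C, hC⟩ := hS.exists_bound_of_continuousOn hLp.continuousOn
    exact Integrable.of_bound hLp.aestronglyMeasurable C (hae.mono hC)
  have hΦν : γ ≤ ∫ z, (Q z - 2 * β * logPotential K z) ∂ν := by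
    have : ∫ _, γ ∂ν ≤ ∫ z, (Q z - 2 * β * logPotential K z) ∂ν := by
      refine integral_mono_ae (integrable_const _) (hfin.pot_integrable.sub (hLν.const_mul _)) ?_
      filter_upwards [hae, hFν] with z h1 h2 using hge z h1 h2
    simpa using this
  rw [integral_sub hfin.pot_integrable (hLν.const_mul _), integral_const_mul] at hΦν
  have hLK : IntegrableOn (logPotential K) K := hLp.continuousOn.integrableOn_compact hK
  have hΦK : ∫ z in K, (Q z - 2 * β * logPotential K z) = volume.real K * γ := by
    rw [← smul_eq_mul (volume.real K), ← setIntegral_const]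
    refine integral_congr_ae ?_
    filter_upwards [hFK, ae_restrict_mem hK.measurableSet] with z h1 h2 using heq z h2 h1
  rw [integral_sub hQK (hLK.const_mul _), integral_const_mul] at hΦK
  have hμμ : ∫ p : ℂ × ℂ, Real.log (1 / ‖p.1 - p.2‖) ∂(μ.prod μ) =
      -(β * β * ∫ z in K, logPotential K z) := by
    have h1 : ∫ z, Q z ∂μ = β * ∫ z in K, Q z := by
      rw [hμ, integral_smul_measure, ENNReal.toReal_ofReal hβ, smul_eq_mul]
    rw [energy, h1] at hμen
    linarith
  rw [hμen]
  rw [hμμ] at hpos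
  rw [energy]
  have h5 : β * (volume.real K * γ) = γ := by rw [← mul_assoc, hprob, one_mul]
  rw [← hΦK] at h5
  linarith

end HeleShaw

end

/-! ### Droplet measures, supports and areas of filled sets -/

noncomputable section

namespace HeleShaw

open Metric Filter Topology InnerProductSpace

theorem laplacian_norm_sq (z : ℂ) : Laplacian.laplacian (fun x : ℂ => ‖x‖ ^ 2) z = 4 := by
  have h1 : fderiv ℝ (fun x : ℂ => ‖x‖ ^ 2) = fun x => (2 : ℝ) • innerSL ℝ x := by
    ext1 x
    rw [(hasStrictFDerivAt_norm_sq x).hasFDerivAt.fderiv]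
    ext1 y
    simp
    ring
  have h2 : ∀ x : ℂ, HasFDerivAt (fun x : ℂ => (2 : ℝ) • innerSL ℝ x)
      ((2 : ℝ) • (innerSL ℝ : ℂ →L[ℝ] ℂ →L[ℝ] ℝ)) x := fun x =>
    ((2 : ℝ) • (innerSL ℝ : ℂ →L[ℝ] ℂ →L[ℝ] ℝ)).hasFDerivAt
  rw [laplacian_eq_iteratedFDeriv_complexPlane]
  simp only [iteratedFDeriv_two_apply, h1, (h2 z).fderiv]
  have h3 : ∀ x : ℂ, (innerSL ℝ x) x = ‖x‖ ^ 2 := real_inner_self_eq_norm_sq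
  simp [h3]
  norm_num

theorem contDiffAt_norm_sq_complex (z : ℂ) : ContDiffAt ℝ 2 (fun x : ℂ => ‖x‖ ^ 2) z :=
  (contDiff_norm_sq ℝ).contDiffAt

theorem laplacian_smul_norm_sq_sub {H : ℂ → ℝ} {z : ℂ} (hH : HarmonicAt H z) (k : ℝ) :
    ContDiffAt ℝ 2 (k • ((fun x : ℂ => ‖x‖ ^ 2) - H)) z ∧
    Laplacian.laplacian (k • ((fun x : ℂ => ‖x‖ ^ 2) - H)) z = k * 4 := by
  have h1 := contDiffAt_norm_sq_complex z
  have h2 : ContDiffAt ℝ 2 ((fun x : ℂ => ‖x‖ ^ 2) - H) z := h1.sub hH.1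
  refine ⟨h2.const_smul k, ?_⟩
  rw [laplacian_smul k h2, h1.laplacian_sub hH.1, laplacian_norm_sq,
    hH.2.self_of_nhds]
  simp

theorem harmonicAt_sum_log {m : ℕ} (a : Fin m → ℂ) (c : Fin m → ℝ) {z : ℂ} (hz : ∀ j, z ≠ a j) :
    HarmonicAt (fun x => ∑ j, c j * Real.log ‖x - a j‖) z := by
  have hlog : ∀ j, HarmonicAt (fun x => c j * Real.log ‖x - a j‖) z := fun j =>
    HarmonicAt.const_smul (c := c j) (AnalyticAt.harmonicAt_log_norm (f := fun x => x - a j)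
      (by fun_prop) (sub_ne_zero.2 (hz j)))
  have : ∀ s : Finset (Fin m), HarmonicAt (fun x => ∑ j ∈ s, c j * Real.log ‖x - a j‖) z := by
    intro s
    induction s using Finset.induction_on with
    | empty => simp
    | insert j s hj ih =>
      simp only [Finset.sum_insert hj]
      exact (hlog j).add ih
  exact this Finset.univ

theorem dropletMeasure_eq {Q : ℂ → ℝ} {K : Set ℂ} {t : ℝ} (hK : MeasurableSet K)
    (h : ∀ z ∈ K, Laplacian.laplacian Q z = 4 / t) :
    dropletMeasure Q K = ENNReal.ofReal (1 / (Real.pi * t)) • volume.restrict K := by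
  rw [dropletMeasure, ← withDensity_const]
  refine withDensity_congr_ae ?_
  filter_upwards [ae_restrict_mem hK] with z hz
  rw [h z hz]
  congr 1
  have := Real.pi_pos
  field_simp

theorem mul_measureReal_eq_one {K : Set ℂ} {β : ℝ} (hβ : 0 ≤ β) (hK : IsCompact K)
    (h : IsProbabilityMeasure (ENNReal.ofReal β • volume.restrict K)) :
    β * volume.real K = 1 := by
  have h1 := h.measure_univ
  rw [Measure.smul_apply, Measure.restrict_apply_univ, smul_eq_mul,
    ← ofReal_measureReal hK.measure_lt_top.ne, ← ENNReal.ofReal_mul hβ,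
    ENNReal.ofReal_eq_one] at h1
  exact h1

/-- A nonnegative function with vanishing integral over `K` vanishes on `K`, if it is continuous
and `K` carries positive area near each of its points. -/
theorem eq_zero_of_setIntegral_eq_zero {K : Set ℂ} {f : ℂ → ℝ} (hK : IsCompact K)
    (hsupp : ∀ z ∈ K, ∀ V ∈ 𝓝 z, 0 < volume.restrict K V) (hf : ContinuousOn f K)
    (hnn : ∀ z ∈ K, 0 ≤ f z) (hint : ∫ z in K, f z = 0) : ∀ z ∈ K, f z = 0 := by
  intro z hz
  by_contra hne
  have hpos : 0 < f z := lt_of_le_of_ne (hnn z hz) (Ne.symm hne)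
  have hae : f =ᵐ[volume.restrict K] 0 := by
    refine (integral_eq_zero_iff_of_nonneg_ae ?_ (hf.integrableOn_compact hK)).1 hint
    filter_upwards [ae_restrict_mem hK.measurableSet] with x hx using hnn x hx
  obtain ⟨V, hV, hVK⟩ := mem_nhdsWithin_iff_exists_mem_nhds_inter.1
    ((hf z hz).eventually (lt_mem_nhds hpos))
  have hnull : ∀ᵐ x ∂(volume.restrict K), x ∉ V := by
    filter_upwards [hae, ae_restrict_mem hK.measurableSet] with x hx hxK hxV
    have : 0 < f x := hVK ⟨hxV, hxK⟩
    rw [hx] at this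
    exact lt_irrefl _ this
  exact (hsupp z hz V hV).ne' (measure_eq_zero_iff_ae_notMem.2 hnull)

theorem support_smul_restrict {K : Set ℂ} {β : ℝ} (hβ : 0 < β) (hK : IsClosed K)
    (h : ∀ z ∈ K, ∀ V ∈ 𝓝 z, 0 < volume.restrict K V) :
    (ENNReal.ofReal β • volume.restrict K).support = K := by
  have hβ' : ENNReal.ofReal β ≠ 0 := (ENNReal.ofReal_pos.2 hβ).ne'
  ext z
  rw [Measure.mem_support_iff_forall]
  constructor
  · intro hz
    by_contra hzK
    have := hz Kᶜ (hK.isOpen_compl.mem_nhds hzK)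
    simp [Measure.restrict_apply hK.isOpen_compl.measurableSet] at this
  · intro hz V hV
    rw [Measure.smul_apply, smul_eq_mul]
    exact ENNReal.mul_pos hβ' (h z hz V hV).ne'

theorem restrict_pos_of_support {K : Set ℂ} {β : ℝ}
    (h : (ENNReal.ofReal β • volume.restrict K).support = K) :
    ∀ z ∈ K, ∀ V ∈ 𝓝 z, 0 < volume.restrict K V := by
  intro z hz V hV
  rw [← h, Measure.mem_support_iff_forall] at hz
  have := hz V hV
  rw [Measure.smul_apply, smul_eq_mul] at this
  exact pos_of_ne_zero fun h0 => by simp [h0] at this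

theorem restrict_filled_pos {K : Set ℂ} (hK : IsCompact K) (hne : K.Nonempty)
    (h : ∀ z ∈ K, ∀ V ∈ 𝓝 z, 0 < volume.restrict K V) :
    ∀ z ∈ filled K, ∀ V ∈ 𝓝 z, 0 < volume.restrict (filled K) V := by
  intro z hz V hV
  by_cases hzK : z ∈ K
  · exact (h z hzK V hV).trans_le (Measure.restrict_mono_set _ (subset_filled K) V)
  · have hW : (filled K \ K) ∩ V ∈ 𝓝 z :=
      inter_mem ((isOpen_filled_diff hK hne).mem_nhds ⟨hz, hzK⟩) hV
    calc 0 < volume ((filled K \ K) ∩ V) := Measure.measure_pos_of_mem_nhds _ hW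
      _ = volume.restrict (filled K) ((filled K \ K) ∩ V) :=
          (Measure.restrict_eq_self _ (inter_subset_left.trans sdiff_subset)).symm
      _ ≤ volume.restrict (filled K) V := measure_mono inter_subset_right

theorem logPotential_filled {K : Set ℂ} (hK : IsCompact K) (z : ℂ) :
    logPotential (filled K) z = logPotential K z + logPotential (filled K \ K) z := by
  have hf := integrableOn_log_norm_sub' z (isCompact_filled hK).isBounded
  rw [logPotential, logPotential, logPotential, ← union_sdiff_cancel (subset_filled K),
    setIntegral_union disjoint_sdiff_right
      ((isCompact_filled hK).measurableSet.diff hK.measurableSet)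
      (hf.mono_set (subset_filled K)) (hf.mono_set sdiff_subset), union_sdiff_cancel (subset_filled K)]

theorem measureReal_filled {K : Set ℂ} (hK : IsCompact K) :
    volume.real (filled K) = volume.real K + volume.real (filled K \ K) := by
  have h := measureReal_sdiff_add_inter (μ := (volume : Measure ℂ)) (s := filled K)
    hK.measurableSet (isCompact_filled hK).measure_lt_top.ne
  rw [inter_eq_self_of_subset_right (subset_filled K)] at h
  linarith

/-! ### From a local droplet with point charges to the filled droplet -/

section Droplet

variable {t₀ : ℝ} {H₀ : ℂ → ℝ} {m : ℕ} {a : Fin m → ℂ} {c : Fin m → ℝ} {K N : Set ℂ}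

/-- Reduction of the droplet condition to the obstacle problem. -/
theorem exists_solvesObstacle (ht₀ : 0 < t₀) (hN : IsOpen N) (hH : HarmonicOnNhd H₀ N)
    (hfN : filled K ⊆ N) (hne : K.Nonempty) (ha : ∀ j, a j ∈ filled K \ K) {U : Set ℂ}
    (hU : IsOpen U) (hKU : K ⊆ U)
    (hD : IsDropletOn
      (fun z => potential t₀ H₀ z - 2 * ∑ j, c j * Real.log ‖z - a j‖) (closure U) K) :
    volume.real K = Real.pi * t₀ ∧ (∀ z ∈ K, ∀ V ∈ 𝓝 z, 0 < volume.restrict K V) ∧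
    ∃ γ ρ : ℝ, SolvesObstacle K (fun z => H₀ z + t₀ * γ) a (fun j => t₀ * c j) ρ ∧
      ∀ z ∈ U, z ∈ N → (∀ j, z ≠ a j) →
        0 ≤ obstacle K (fun z => H₀ z + t₀ * γ) a (fun j => t₀ * c j) z := by
  set Q : ℂ → ℝ := fun z => potential t₀ H₀ z - 2 * ∑ j, c j * Real.log ‖z - a j‖ with hQ
  have hK := hD.compact
  have hpi := Real.pi_pos
  set β : ℝ := 1 / (Real.pi * t₀) with hβdef
  have hβ : 0 < β := by positivity
  have haK : ∀ z ∈ K, ∀ j, z ≠ a j := fun z hz j h => (ha j).2 (h ▸ hz)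
  have hKN : K ⊆ N := (subset_filled K).trans hfN
  have hsmooth : ∀ z ∈ N, (∀ j, z ≠ a j) →
      ContDiffAt ℝ 2 Q z ∧ Laplacian.laplacian Q z = 4 / t₀ := by
    intro z hz hza
    have h2 := (harmonicAt_sum_log a c hza).const_smul (c := t₀ * 2)
    have h := laplacian_smul_norm_sq_sub ((hH z hz).add h2) (1 / t₀)
    have e : Q = (1 / t₀) • ((fun x : ℂ => ‖x‖ ^ 2) -
        (H₀ + (t₀ * 2) • fun x => ∑ j, c j * Real.log ‖x - a j‖)) := by
      ext x
      simp only [hQ, potential, Pi.smul_apply, Pi.sub_apply, Pi.add_apply, smul_eq_mul]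
      field_simp
      ring
    rw [e]
    exact ⟨h.1, by rw [h.2]; ring⟩
  have hμ : dropletMeasure Q K = ENNReal.ofReal β • volume.restrict K :=
    dropletMeasure_eq hK.measurableSet fun z hz => (hsmooth z (hKN hz) (haK z hz)).2
  have hcontK : ContinuousOn Q K := fun z hz =>
    (hsmooth z (hKN hz) (haK z hz)).1.continuousAt.continuousWithinAt
  have hprob : β * volume.real K = 1 := mul_measureReal_eq_one hβ.le hK (hμ ▸ hD.prob)
  have hsupp := restrict_pos_of_support (hμ ▸ hD.support_eq)
  have hmin := hD.minimal
  rw [hμ] at hmin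
  set Φ : ℂ → ℝ := fun z => Q z - 2 * β * logPotential K z with hΦ
  set γ : ℝ := β * ∫ w in K, Φ w with hγ
  have hopen : IsOpen (U ∩ N ∩ (range a)ᶜ) :=
    (hU.inter hN).inter (finite_range a).isClosed.isOpen_compl
  have hEL : ∀ z ∈ U, z ∈ N → (∀ j, z ≠ a j) → γ ≤ Φ z := by
    intro z hzU hzN hza
    refine euler_lagrange hβ.le hK hD.subset (hcontK.integrableOn_compact hK) hprob hmin
      (mem_of_superset (hU.mem_nhds hzU) subset_closure) ?_
    filter_upwards [hopen.mem_nhds ⟨⟨hzU, hzN⟩, fun ⟨j, hj⟩ => hza j hj.symm⟩] with x hx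
    exact (hsmooth x hx.1.2 fun j h => hx.2 ⟨j, h.symm⟩).1.continuousAt
  -- The Euler-Lagrange constant is absorbed into the harmonic part, which becomes `H₀ + t₀ γ`.
  have hobs : ∀ z, obstacle K (fun z => H₀ z + t₀ * γ) a (fun j => t₀ * c j) z =
      t₀ * (Φ z - γ) := by
    intro z
    have : ∑ j, t₀ * c j * Real.log ‖z - a j‖ = t₀ * ∑ j, c j * Real.log ‖z - a j‖ := by
      rw [Finset.mul_sum]
      exact Finset.sum_congr rfl fun j _ => by ring
    simp only [obstacle, this, hΦ, hQ, potential, hβdef]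
    field_simp
    ring
  have hcontΦ : ContinuousOn Φ K :=
    hcontK.sub ((continuous_logPotential hK).continuousOn.const_mul _)
  -- Since `γ` is the mean of `Φ` for the minimising measure, the nonnegative function `Φ - γ` has
  -- integral zero over `K`; the support condition upgrades this to vanishing at every point of `K`.
  have hzero : ∀ z ∈ K, Φ z - γ = 0 := by
    refine eq_zero_of_setIntegral_eq_zero hK hsupp (hcontΦ.sub continuousOn_const)
      (fun z hz => sub_nonneg.2 (hEL z (hKU hz) (hKN hz) (haK z hz))) ?_
    have hconst : IntegrableOn (fun _ : ℂ => γ) K := integrableOn_const hK.measure_lt_top.ne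
    rw [integral_sub (hcontΦ.integrableOn_compact hK) hconst, setIntegral_const, smul_eq_mul]
    have h1 : volume.real K * γ = (β * volume.real K) * ∫ w in K, Φ w := by
      rw [hγ]
      ring
    rw [h1, hprob]
    ring
  have hnn : ∀ z ∈ U, z ∈ N → (∀ j, z ≠ a j) →
      0 ≤ obstacle K (fun z => H₀ z + t₀ * γ) a (fun j => t₀ * c j) z := by
    intro z h1 h2 h3
    rw [hobs]
    exact mul_nonneg ht₀.le (sub_nonneg.2 (hEL z h1 h2 h3))
  have hvol : volume.real K = Real.pi * t₀ := by
    rw [hβdef] at hprob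
    field_simp at hprob
    linarith
  obtain ⟨ρ, hρ, hρsub⟩ := hK.exists_thickening_subset_open hopen fun z hz =>
    ⟨⟨hKU hz, hKN hz⟩, fun ⟨j, hj⟩ => haK z hz j hj.symm⟩
  have hnear : ∀ z, infDist z K < ρ → z ∈ U ∩ N ∩ (range a)ᶜ := fun z hz =>
    hρsub ((mem_thickening_iff_infDist_lt hne).2 hz)
  refine ⟨hvol, hsupp, γ, ρ, ⟨hK, hne, ?_, ha, hρ, ?_, ?_, ?_, ?_⟩, hnn⟩
  · exact fun z hz => (hH z (hfN hz)).add (harmonicAt_const _)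
  · intro j
    by_contra! h
    exact (hnear _ h).2 ⟨j, rfl⟩
  · exact fun z hz => (hH z (hnear z hz).1.2).add (harmonicAt_const _)
  · intro z hz
    obtain ⟨⟨h1, h2⟩, h3⟩ := hnear z hz
    exact hnn z h1 h2 fun j h => h3 ⟨j, h.symm⟩
  · intro z hz
    rw [hobs, hzero z hz, mul_zero]

/-- Sweeping the charges out over the holes turns the obstacle function of `K` into that of the
filled set, to which the sufficient condition for minimality applies. -/
theorem isLocalDroplet_filled (ht₀ : 0 < t₀) (hN : IsOpen N) (hH : HarmonicOnNhd H₀ N)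
    (hfN : filled K ⊆ N) (hne : K.Nonempty) (ha : ∀ j, a j ∈ filled K \ K)
    (hdrop : IsLocalDroplet
      (fun z => potential t₀ H₀ z - 2 * ∑ j, c j * Real.log ‖z - a j‖) K) :
    IsLocalDroplet (fun z => potential t₀ H₀ z / (1 + ∑ j, c j)) (filled K) := by
  obtain ⟨U, hU, hKU, hD⟩ := hdrop
  have hK := hD.compact
  have hKf := isCompact_filled hK
  obtain ⟨hvol, hsupp, γ, ρ, hs, hnn⟩ := exists_solvesObstacle ht₀ hN hH hfN hne ha hU hKU hD
  have hpi := Real.pi_pos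
  set C : ℝ := 1 + ∑ j, c j with hC
  have hvolW : volume.real (filled K \ K) = Real.pi * t₀ * ∑ j, c j := by
    rw [hs.volume_holes, ← Finset.mul_sum]
    ring
  have hvolf : volume.real (filled K) = Real.pi * (t₀ * C) := by
    rw [measureReal_filled hK, hvol, hvolW, hC]
    ring
  -- The charges may be negative; positivity comes from the area `π t₀ C` of the filled set, which
  -- is at least that of `K`.
  have hCpos : 0 < C := by
    have h1 : 0 < volume.real (filled K) := by
      rw [measureReal_filled hK, hvol]
      exact add_pos_of_pos_of_nonneg (by positivity) measureReal_nonneg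
    rw [hvolf, ← mul_assoc] at h1
    exact (mul_pos_iff_of_pos_left (by positivity)).1 h1
  set β : ℝ := 1 / (Real.pi * (t₀ * C)) with hβdef
  have hβ : 0 < β := by positivity
  set Q : ℂ → ℝ := fun z => potential t₀ H₀ z / C with hQ
  have hsmooth : ∀ z ∈ N, ContDiffAt ℝ 2 Q z ∧ Laplacian.laplacian Q z = 4 / (t₀ * C) := by
    intro z hz
    have h := laplacian_smul_norm_sq_sub (hH z hz) (1 / (t₀ * C))
    have e : Q = (1 / (t₀ * C)) • ((fun x : ℂ => ‖x‖ ^ 2) - H₀) := by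
      ext x
      simp only [hQ, potential, Pi.smul_apply, Pi.sub_apply, smul_eq_mul]
      field_simp
    rw [e]
    exact ⟨h.1, by rw [h.2]; ring⟩
  have hμ : dropletMeasure Q (filled K) = ENNReal.ofReal β • volume.restrict (filled K) :=
    dropletMeasure_eq hKf.measurableSet fun z hz => (hsmooth z (hfN hz)).2
  have hprob : β * volume.real (filled K) = 1 := by
    rw [hvolf, hβdef]
    field_simp
  -- Points of the closure of `V` outside the filled set must lie in `U`, where the original
  -- inequality is available. Compactness of the closure is needed for the sufficiency argument.
  obtain ⟨V, hV, hfV, hclV, hcV⟩ := exists_open_between_and_isCompact_closure hKf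
    ((hs.isOpen_holes.union hU).inter hN) (fun z hz => by
      refine ⟨?_, hfN hz⟩
      by_cases h : z ∈ K
      · exact Or.inr (hKU h)
      · exact Or.inl ⟨hz, h⟩)
  have hcontQ : ContinuousOn Q (closure V) := fun z hz =>
    (hsmooth z (hclV hz).2).1.continuousAt.continuousWithinAt
  -- The potential representation trades the potential of the holes for the charges plus the cut-off
  -- obstacle function. The points `a j` are excluded, as the logarithms there carry the default
  -- value `0`.
  have hΦ : ∀ z, (∀ j, z ≠ a j) → Q z - 2 * β * logPotential (filled K) z =
      1 / (t₀ * C) * (obstacle K (fun z => H₀ z + t₀ * γ) a (fun j => t₀ * c j) z -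
        holeObstacle K (fun z => H₀ z + t₀ * γ) a (fun j => t₀ * c j) z) + γ / C := by
    intro z hza
    rw [hs.holeObstacle_eq hza, logPotential_filled hK]
    simp only [obstacle, hQ, potential, hβdef]
    field_simp
    ring
  have hon : ∀ z ∈ filled K, z ∉ range a → Q z - 2 * β * logPotential (filled K) z = γ / C := by
    intro z hz hza
    rw [hΦ z fun j h => hza ⟨j, h.symm⟩, holeObstacle]
    by_cases h : z ∈ K
    · rw [hs.zero z h, indicator_of_notMem fun h' => h'.2 h]
      simp
    · rw [indicator_of_mem (show z ∈ filled K \ K from ⟨hz, h⟩)]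
      simp
  have hoff : ∀ z ∈ closure V, z ∉ range a →
      γ / C ≤ Q z - 2 * β * logPotential (filled K) z := by
    intro z hz hza
    by_cases h : z ∈ filled K
    · exact (hon z h hza).ge
    · have hza' : ∀ j, z ≠ a j := fun j h' => hza ⟨j, h'.symm⟩
      rw [hΦ z hza', holeObstacle, indicator_of_notMem fun h' => h h'.1, sub_zero]
      have hzU : z ∈ U := (hclV hz).1.resolve_left fun h' => h h'.1
      have := hnn z hzU (hclV hz).2 hza'
      have h2 : 0 ≤ 1 / (t₀ * C) * obstacle K (fun z => H₀ z + t₀ * γ) a (fun j => t₀ * c j) z := by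
        positivity
      linarith
  have hfcl : filled K ⊆ closure V := hfV.trans subset_closure
  refine ⟨V, hV, hfV, hKf, hfcl, ?_, ?_, ?_, ?_⟩
  · rw [hμ]
    have := isProbabilityMeasure_combination hKf isCompact_empty hβ.le (le_refl (0 : ℝ))
      (by rw [hprob]; simp)
    simpa using this
  · rw [hμ]
    exact support_smul_restrict hβ hKf.isClosed (restrict_filled_pos hK hne hsupp)
  · rw [hμ]
    exact (energy_smul_restrict hKf ((hcontQ.mono hfcl).integrableOn_compact hKf) hβ.le).1
  · intro ν hν hν0 hfin
    rw [hμ]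
    exact energy_le_of_obstacle hβ.le hcV hKf hfcl hcontQ hprob (finite_range a) hon hoff hν0 hfin

end Droplet

end HeleShaw

end

theorem lemma5p1
    (t₀ : ℝ) (ht₀ : 0 < t₀)
    (rinf : RatFunc ℂ) (H₀ : ℂ → ℝ) (hH₀ : HeleShaw.IsHarmonicWith H₀ rinf)
    (m : ℕ) (a : Fin m → ℂ) (c : Fin m → ℝ)
    (K : Set ℂ) (hK : IsConnected K)
    (hdrop : HeleShaw.IsLocalDroplet
      (fun z => HeleShaw.potential t₀ H₀ z - 2 * ∑ j, c j * Real.log ‖z - a j‖) K)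
    (hpoles : ∀ p : ℂ, rinf.denom.IsRoot p → p ∈ HeleShaw.outerComponent K)
    (ha : ∀ j, a j ∈ HeleShaw.filled K \ K) :
    HeleShaw.IsSimplyConnectedCompact (HeleShaw.filled K) ∧
      HeleShaw.IsLocalDroplet
        (fun z => HeleShaw.potential t₀ H₀ z / (1 + ∑ j, c j)) (HeleShaw.filled K) := by
  have hKc : IsCompact K := by
    obtain ⟨U, -, -, hD⟩ := hdrop
    exact hD.compact
  refine ⟨HeleShaw.isSimplyConnectedCompact_filled hKc hK, ?_⟩
  have hfin : {z : ℂ | rinf.denom.IsRoot z}.Finite :=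
    Polynomial.finite_setOfPred_isRoot rinf.denom_ne_zero
  -- The poles are finitely many and lie in the unbounded component, so their complement is an open
  -- neighbourhood of the filled set on which `H₀` is harmonic.
  exact HeleShaw.isLocalDroplet_filled (N := {z : ℂ | rinf.denom.IsRoot z}ᶜ) ht₀
    hfin.isClosed.isOpen_compl (fun z hz => hH₀.harmonic z hz)
    (fun z hz hroot => hz (hpoles z hroot)) hK.nonempty ha hdrop
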